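/- Let $n\ge 1$ and $J\ge 1$ be integers, let $\mathbb B_n$ be the open unit ball of $\mathbb C^n$, let $v$ be Lebesgue measure on $\mathbb B_n$ normalized so that $v(\mathbb B_n)=1$, and let $s$ be the normalized surface measure on $\partial\mathbb B_n$. The Hardy space $\mathcal H^2(\mathbb B_n)$ is the space of holomorphic $f:\mathbb B_n\to\mathbb C$ with $$\|f\|_{\mathcal H^2(\mathbb B_n)}:=\sup_{0<r<1}\left(\int_{\partial\mathbb B_n}|f(r\zeta)|^2\,ds(\zeta)\right)^{1/2}<\infty,$$ equipped with this norm. Let $\mathcal F\subseteq\mathcal H^2(\mathbb B_n)$ be a bounded set. Then $\mathcal F$ is precompact, i.e. its closure in $\mathcal H^2(\mathbb B_n)$ is compact, if and only if $$\lim_{r\to1^-}\ \sup_{f\in\mathcal F}\ \sum_{|\alpha|=J}\int_{\mathbb B_n\setminus r\mathbb B_n}\left|\frac{\partial^\alpha f}{\partial z^\alpha}(w)\right|^2(1-|w|^2)^{2J-1}\,dv(w)=0,$$ where the sum runs over the multi-indices $\alpha\in\mathbb N^n$ with $|\alpha|=\alpha_1+\dots+\alpha_n=J$ and $\partial^\alpha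 f/\partial z^\alpha$ denotes the complex partial derivative; the supremum over the empty set is $0$. -/

import Mathlib

open MeasureTheory Filter Topology Metric
open scoped ENNReal

noncomputable section

/-- `ℂⁿ` with its Euclidean norm. -/
abbrev Cn (n : ℕ) : Type := EuclideanSpace ℂ (Fin n)

/-- The open unit ball `𝔹ₙ` of `ℂⁿ`. -/
abbrev unitBall (n : ℕ) : Set (Cn n) := ball (0 : Cn n) 1

/-- Normalized Lebesgue measure `v` on the unit ball of `ℂⁿ`. -/
def ballMeasure (n : ℕ) : Measure (Cn n) :=
  (volume (unitBall n))⁻¹ • (volume.restrict (unitBall n))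

/-- Normalized surface measure `s` on the unit sphere of `ℂⁿ`. -/
def sphereMeasure (n : ℕ) : Measure (sphere (0 : Cn n) 1) :=
  ((volume : Measure (Cn n)).toSphere Set.univ)⁻¹ • (volume : Measure (Cn n)).toSphere

open Classical in
/-- Extension of a function on the ball by zero to `ℂⁿ`; only its values on the (open) ball are
ever used, so that derivatives at points of the ball do not depend on the extension. -/
def zeroExt {n : ℕ} (f : unitBall n → ℂ) : Cn n → ℂ :=
  fun z => if h : z ∈ unitBall n then f ⟨z, h⟩ else 0

/-- `f : 𝔹ₙ → ℂ` is holomorphic. -/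
def IsHolomorphicOnBall {n : ℕ} (f : unitBall n → ℂ) : Prop :=
  DifferentiableOn ℂ (zeroExt f) (unitBall n)

/-- The complex partial derivative `∂g/∂zᵢ`. -/
def complexPartial {n : ℕ} (i : Fin n) (g : Cn n → ℂ) : Cn n → ℂ :=
  fun z => fderiv ℂ g z (EuclideanSpace.single i 1)

/-- The iterated complex partial derivative
`∂^α g / ∂z^α = (∂/∂z₀)^(α 0) ⋯ (∂/∂zₙ₋₁)^(α (n-1)) g`. -/
def complexPartialMulti {n : ℕ} (α : Fin n → ℕ) (g : Cn n → ℂ) : Cn n → ℂ :=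
  (List.finRange n).foldr (fun i h => (complexPartial i)^[α i] h) g

/-- `sup_{0<r<1} (∫_{∂𝔹ₙ} |f(rζ)|² ds(ζ))^{1/2}`, with values in `[0,∞]`. -/
def hardyENorm {n : ℕ} (f : unitBall n → ℂ) : ℝ≥0∞ :=
  ⨆ r ∈ Set.Ioo (0 : ℝ) 1,
    (∫⁻ ζ : sphere (0 : Cn n) 1, ‖zeroExt f (r • (ζ : Cn n))‖ₑ ^ 2 ∂(sphereMeasure n))
      ^ (1 / 2 : ℝ)

section Helpers

variable {n : ℕ}

theorem zeroExt_of_mem (f : unitBall n → ℂ) {z : Cn n} (h : z ∈ unitBall n) :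
    zeroExt f z = f ⟨z, h⟩ := by
  simp only [zeroExt, dif_pos h]

theorem zeroExt_zero : zeroExt (0 : unitBall n → ℂ) = 0 := by
  funext z
  by_cases h : z ∈ unitBall n
  · rw [zeroExt_of_mem _ h]; rfl
  · simp only [zeroExt, dif_neg h]; rfl

theorem zeroExt_add (f g : unitBall n → ℂ) : zeroExt (f + g) = zeroExt f + zeroExt g := by
  funext z
  by_cases h : z ∈ unitBall n
  · simp only [Pi.add_apply, zeroExt_of_mem _ h]
  · simp only [zeroExt, dif_neg h, Pi.add_apply, add_zero]

theorem zeroExt_smul (c : ℂ) (f : unitBall n → ℂ) : zeroExt (c • f) = c • zeroExt f := by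
  funext z
  by_cases h : z ∈ unitBall n
  · simp only [Pi.smul_apply, zeroExt_of_mem _ h]
  · simp only [zeroExt, dif_neg h, Pi.smul_apply, smul_zero]

theorem smul_mem_unitBall {r : ℝ} (hr : r ∈ Set.Ioo (0 : ℝ) 1) (ζ : sphere (0 : Cn n) 1) :
    r • (ζ : Cn n) ∈ unitBall n := by
  have h1 : ‖(ζ : Cn n)‖ = 1 := by simp
  simp [norm_smul, h1, abs_of_pos hr.1, hr.2]

theorem IsHolomorphicOnBall.continuous_dilate {f : unitBall n → ℂ} (hf : IsHolomorphicOnBall f)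
    {r : ℝ} (hr : r ∈ Set.Ioo (0 : ℝ) 1) :
    Continuous (fun ζ : sphere (0 : Cn n) 1 => zeroExt f (r • (ζ : Cn n))) :=
  hf.continuousOn.comp_continuous (by fun_prop) (fun ζ => smul_mem_unitBall hr ζ)

theorem hardyENorm_eq (f : unitBall n → ℂ) :
    hardyENorm f = ⨆ r ∈ Set.Ioo (0 : ℝ) 1,
      eLpNorm (fun ζ : sphere (0 : Cn n) 1 => zeroExt f (r • (ζ : Cn n))) 2
        (sphereMeasure n) := by
  simp [hardyENorm, eLpNorm_eq_lintegral_rpow_enorm_toReal (p := 2) (by norm_num) (by norm_num)]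

theorem hardyENorm_zero : hardyENorm (0 : unitBall n → ℂ) = 0 := by
  simp [hardyENorm, zeroExt_zero]

theorem hardyENorm_add_le {f g : unitBall n → ℂ} (hf : IsHolomorphicOnBall f)
    (hg : IsHolomorphicOnBall g) :
    hardyENorm (f + g) ≤ hardyENorm f + hardyENorm g := by
  rw [hardyENorm_eq (f + g)]
  refine iSup₂_le fun r hr => ?_
  rw [zeroExt_add]
  refine (eLpNorm_add_le (hf.continuous_dilate hr).aestronglyMeasurable
    (hg.continuous_dilate hr).aestronglyMeasurable (by norm_num)).trans ?_
  rw [hardyENorm_eq f, hardyENorm_eq g]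
  exact add_le_add
    (le_iSup₂ (f := fun (r : ℝ) (_ : r ∈ Set.Ioo (0 : ℝ) 1) => eLpNorm
      (fun ζ : sphere (0 : Cn n) 1 => zeroExt f (r • (ζ : Cn n))) 2 (sphereMeasure n)) r hr)
    (le_iSup₂ (f := fun (r : ℝ) (_ : r ∈ Set.Ioo (0 : ℝ) 1) => eLpNorm
      (fun ζ : sphere (0 : Cn n) 1 => zeroExt g (r • (ζ : Cn n))) 2 (sphereMeasure n)) r hr)

theorem hardyENorm_smul (c : ℂ) (f : unitBall n → ℂ) :
    hardyENorm (c • f) = ‖c‖ₑ * hardyENorm f := by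
  simp only [hardyENorm_eq, ENNReal.mul_iSup, zeroExt_smul]
  refine iSup_congr fun r => iSup_congr fun _ => ?_
  exact eLpNorm_const_smul c (fun ζ : sphere (0 : Cn n) 1 => zeroExt f (r • (ζ : Cn n))) 2 _

theorem IsHolomorphicOnBall.add {f g : unitBall n → ℂ} (hf : IsHolomorphicOnBall f)
    (hg : IsHolomorphicOnBall g) : IsHolomorphicOnBall (f + g) := by
  unfold IsHolomorphicOnBall
  rw [zeroExt_add]
  exact DifferentiableOn.add hf hg

theorem IsHolomorphicOnBall.smul (c : ℂ) {f : unitBall n → ℂ} (hf : IsHolomorphicOnBall f) :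
    IsHolomorphicOnBall (c • f) := by
  unfold IsHolomorphicOnBall
  rw [zeroExt_smul]
  exact DifferentiableOn.const_smul hf c

theorem sphereMeasure_isOpenPos (n : ℕ) : (sphereMeasure n).IsOpenPosMeasure := by
  refine Measure.isOpenPosMeasure_smul _ ?_
  exact ENNReal.inv_ne_zero.mpr (measure_ne_top _ _)

theorem eq_zero_of_hardyENorm_eq_zero [NeZero n] {f : unitBall n → ℂ}
    (hf : IsHolomorphicOnBall f) (h0 : hardyENorm f = 0) : f = 0 := by
  have := sphereMeasure_isOpenPos n
  have key : ∀ r ∈ Set.Ioo (0 : ℝ) 1, ∀ ζ : sphere (0 : Cn n) 1,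
      zeroExt f (r • (ζ : Cn n)) = 0 := by
    intro r hr ζ
    rw [hardyENorm_eq] at h0
    have h1 := (iSup₂_eq_bot.mp h0) r hr
    have h2 := (eLpNorm_eq_zero_iff (hf.continuous_dilate hr).aestronglyMeasurable
      (by norm_num)).mp h1
    have h3 := (hf.continuous_dilate hr).ae_eq_iff_eq (sphereMeasure n) continuous_const |>.mp h2
    exact congrFun h3 ζ
  have key2 : ∀ z ∈ unitBall n, z ≠ 0 → zeroExt f z = 0 := by
    intro z hz hz0
    have hpos : 0 < ‖z‖ := norm_pos_iff.mpr hz0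
    have hz1 : ‖z‖ < 1 := by simpa using hz
    have := key ‖z‖ ⟨hpos, hz1⟩ ⟨(‖z‖⁻¹ : ℝ) • z, by
      simp [norm_smul, hpos.ne']⟩
    simpa [smul_smul, hpos.ne'] using this
  funext ⟨z, hz⟩
  rw [← zeroExt_of_mem f hz]
  by_cases hz0 : z = 0
  · subst hz0
    have hc : ContinuousAt (zeroExt f) 0 :=
      (hf.continuousOn).continuousAt (isOpen_ball.mem_nhds hz)
    have ht : Tendsto (zeroExt f) (𝓝[≠] (0 : Cn n)) (𝓝 (zeroExt f 0)) :=
      hc.tendsto.mono_left nhdsWithin_le_nhds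
    have ht0 : Tendsto (zeroExt f) (𝓝[≠] (0 : Cn n)) (𝓝 0) := by
      refine tendsto_const_nhds.congr' ?_
      filter_upwards [self_mem_nhdsWithin,
        mem_nhdsWithin_of_mem_nhds (isOpen_ball.mem_nhds hz)] with w hw hwb
      exact (key2 w hwb hw).symm
    have : (𝓝[≠] (0 : Cn n)).NeBot := Module.punctured_nhds_neBot ℂ (Cn n) 0
    exact tendsto_nhds_unique ht ht0
  · exact key2 z hz hz0

end Helpers

/-- The vector space of holomorphic `f : 𝔹ₙ → ℂ` with
`sup_{0<r<1} (∫_{∂𝔹ₙ} |f(rζ)|² ds(ζ))^{1/2} < ∞`. -/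
def hardySubmodule (n : ℕ) : Submodule ℂ (unitBall n → ℂ) where
  carrier := {f | IsHolomorphicOnBall f ∧ hardyENorm f < ∞}
  zero_mem' := by
    refine ⟨?_, ?_⟩
    · unfold IsHolomorphicOnBall
      rw [zeroExt_zero]
      exact differentiableOn_const 0
    · rw [hardyENorm_zero]; exact ENNReal.zero_lt_top
  add_mem' := fun hf hg => ⟨hf.1.add hg.1,
    (hardyENorm_add_le hf.1 hg.1).trans_lt (ENNReal.add_lt_top.mpr ⟨hf.2, hg.2⟩)⟩
  smul_mem' := fun c f hf => ⟨hf.1.smul c, by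
    rw [hardyENorm_smul]; exact ENNReal.mul_lt_top enorm_lt_top hf.2⟩

/-- The Hardy space `𝓗²(𝔹ₙ)`. It is a type of its own (not the coercion of the submodule) so that
its topology is that of the Hardy norm and not that of pointwise convergence. -/
def HardySpace (n : ℕ) : Type := ↥(hardySubmodule n)

instance HardySpace.instAddCommGroup (n : ℕ) : AddCommGroup (HardySpace n) :=
  inferInstanceAs (AddCommGroup ↥(hardySubmodule n))

instance HardySpace.instModule (n : ℕ) : Module ℂ (HardySpace n) :=
  inferInstanceAs (Module ℂ ↥(hardySubmodule n))

/-- The underlying function `𝔹ₙ → ℂ` of an element of the Hardy space. -/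
def HardySpace.toFun {n : ℕ} (f : HardySpace n) : unitBall n → ℂ := Subtype.val f

/-- The Hardy norm as a group norm on `𝓗²(𝔹ₙ)`. -/
def hardyGroupNorm (n : ℕ) [NeZero n] : AddGroupNorm (HardySpace n) where
  toFun f := (hardyENorm f.toFun).toReal
  map_zero' := by
    change (hardyENorm (0 : unitBall n → ℂ)).toReal = 0
    rw [hardyENorm_zero]; rfl
  add_le' f g := by
    change (hardyENorm (f.toFun + g.toFun)).toReal ≤ _
    have hf : hardyENorm f.toFun ≠ ∞ := f.2.2.ne
    have hg : hardyENorm g.toFun ≠ ∞ := g.2.2.ne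
    rw [← ENNReal.toReal_add hf hg]
    exact ENNReal.toReal_mono (ENNReal.add_lt_top.mpr ⟨f.2.2, g.2.2⟩).ne
      (hardyENorm_add_le f.2.1 g.2.1)
  neg' f := by
    change (hardyENorm (-f.toFun)).toReal = _
    have h : -f.toFun = (-1 : ℂ) • f.toFun := by simp
    rw [h, hardyENorm_smul]
    simp
  eq_zero_of_map_eq_zero' f h := by
    have h1 : hardyENorm f.toFun = 0 :=
      ((ENNReal.toReal_eq_zero_iff _).mp h).resolve_right f.2.2.ne
    exact Subtype.ext (eq_zero_of_hardyENorm_eq_zero f.2.1 h1)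

/-- `𝓗²(𝔹ₙ)` with `‖f‖ = sup_{0<r<1} (∫_{∂𝔹ₙ} |f(rζ)|² ds(ζ))^{1/2}`. -/
instance HardySpace.instNormedAddCommGroup (n : ℕ) [NeZero n] :
    NormedAddCommGroup (HardySpace n) :=
  { (hardyGroupNorm n).toNormedAddCommGroup with
    toAddCommGroup := HardySpace.instAddCommGroup n }

theorem HardySpace.norm_def {n : ℕ} [NeZero n] (f : HardySpace n) :
    ‖f‖ = (hardyENorm f.toFun).toReal := rfl

instance HardySpace.instNormedSpace (n : ℕ) [NeZero n] : NormedSpace ℂ (HardySpace n) where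
  norm_smul_le c f := by
    rw [HardySpace.norm_def, HardySpace.norm_def]
    change (hardyENorm (c • f.toFun)).toReal ≤ _
    rw [hardyENorm_smul]
    simp

/-- The weighted tail
`∑_{|α|=J} ∫_{𝔹ₙ ∖ r𝔹ₙ} |∂^α f/∂z^α (w)|² (1-|w|²)^(2J-1) dv(w)`, with values in `[0,∞]`,
for an integer `J ≥ 1`. -/
def weightedTail {n : ℕ} (J : ℕ) (r : ℝ) (f : unitBall n → ℂ) : ℝ≥0∞ :=
  ∑ α ∈ Finset.piAntidiag (Finset.univ : Finset (Fin n)) J,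
    ∫⁻ w in unitBall n \ ball (0 : Cn n) r,
      ‖complexPartialMulti α (zeroExt f) w‖ₑ ^ 2 * ENNReal.ofReal ((1 - ‖w‖ ^ 2) ^ (2 * J - 1))
        ∂(ballMeasure n)

end

/-! Split `f` into homogeneous parts `f_k` (`taylorPart`); everything becomes diagonal in `k`. On
each complex line through the origin the parts are the Fourier modes of the slice. Since the surface
measure is invariant under `ζ ↦ e^{iθ}ζ`, Parseval on slices gives `‖f‖² = ∑ ‖f_k‖²`, with norms in
`L²` of the sphere (`hardyENorm_sq`).

Derivatives are handled in the Fock space. There `∂/∂zᵢ` is adjoint to multiplication by `zᵢ`, so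
Euler's identity and polar coordinates give `∑ᵢ ‖∂ᵢp‖² = (k+1)(n+k) ‖p‖²` on the sphere for `p` of
degree `k+1` (`sum_sphereSqNorm_complexPartial`). Iterating `J` times, the weighted tail is
comparable, up to the factor `n^J`, to `∑ m_k(r) ‖f_{k+J}‖²` (`hardyTail`), where `m_k(r)` is
`gradientFactor n k J * tailWeight n J k r`. The first factor is of size `k^{2J}`; the second
integrates `t^{2(n+k)-1}(1-t²)^{2J-1}` over `[r,1)`.

Three properties of the multipliers suffice. They are bounded uniformly in `k` and `r`
(`gradientFactor_mul_tailWeight_le`); each tends to `0` as `r → 1`; and there is a constant `c > 0`,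
independent of `r`, below `m_k(r)` for all large `k` (`le_gradientFactor_mul_tailWeight`).

If the family is totally bounded, the first two properties and dominated convergence make the tail
of each member of a finite net vanish, and uniform boundedness extends this to the whole family.
Conversely, one `r` with a uniformly small tail makes the Taylor remainders beyond a fixed degree
uniformly small, by the third property. The truncations lie in a bounded part of a
finite-dimensional space, so the family is totally bounded, and completeness of the Hardy space
gives compactness of the closure. -/

noncomputable section

/-! ### Holomorphy of integrals depending on a parameter. -/

section ParametricIntegral

variable {E : Type*} [NormedAddCommGroup E] [NormedSpace ℂ E]

theorem norm_fderiv_le_of_norm_le_on_ball {f : E → ℂ} {z : E} {δ M : ℝ} (hδ : 0 < δ)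
    (hf : DifferentiableOn ℂ f (ball z δ)) (hM : ∀ w ∈ ball z δ, ‖f w‖ ≤ M) :
    ‖fderiv ℂ f z‖ ≤ 2 * M / δ := by
  refine Complex.norm_fderiv_le_div_of_mapsTo_ball hf (fun w hw => ?_) hδ
  rw [mem_closedBall, dist_eq_norm]
  calc ‖f w - f z‖ ≤ ‖f w‖ + ‖f z‖ := norm_sub_le _ _
    _ ≤ M + M := add_le_add (hM w hw) (hM z (mem_ball_self hδ))
    _ = 2 * M := by ring

variable [FiniteDimensional ℂ E] [MeasurableSpace E] [BorelSpace E]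
  {T : Type*} [TopologicalSpace T] [CompactSpace T] [MeasurableSpace T] [OpensMeasurableSpace T]
  {μ : Measure T} [IsFiniteMeasure μ]

/-- Differentiation under the integral sign, dominated by means of the Cauchy estimate; no
continuity of `fderiv ℂ f` is assumed. It serves two cases: `a = 1` with `b` running over a circle
(Cauchy's formula for a directional derivative), and `a` on the unit circle with `b = 0`
(homogeneous parts). -/
theorem hasFDerivAt_integral_comp_affine {U : Set E} (hU : IsOpen U) {f : E → ℂ}
    (hf : DifferentiableOn ℂ f U) {φ a : T → ℂ} {b : T → E} (hφ : Continuous φ)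
    (ha : Continuous a) (hb : Continuous b) (ha1 : ∀ t, ‖a t‖ ≤ 1) {z : E}
    (hz : ∀ t, a t • z + b t ∈ U) :
    Integrable (fun t => (φ t * a t) • fderiv ℂ f (a t • z + b t)) μ ∧
    HasFDerivAt (fun w => ∫ t, φ t * f (a t • w + b t) ∂μ)
      (∫ t, (φ t * a t) • fderiv ℂ f (a t • z + b t) ∂μ) z := by
  have hproper : ProperSpace E := FiniteDimensional.proper ℂ E
  have hcont : ∀ w : E, Continuous (fun t => a t • w + b t) := fun w => by fun_prop
  obtain ⟨δ, hδ, hδU⟩ := (isCompact_range (hcont z)).exists_cthickening_subset_open hU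
    (by rintro _ ⟨t, rfl⟩; exact hz t)
  have hK : IsCompact (cthickening δ (Set.range (fun t => a t • z + b t))) :=
    (isCompact_range (hcont z)).cthickening
  obtain ⟨M, hM⟩ := hK.exists_bound_of_continuousOn (hf.continuousOn.mono hδU)
  obtain ⟨C, hC⟩ := isCompact_univ.exists_bound_of_continuousOn hφ.continuousOn
  -- The margin `δ` is shared: half for moving the parameter `w`, half for the radius of the Cauchy
  -- estimate.
  have hmem : ∀ t, ∀ w ∈ ball z (δ / 2), ∀ y ∈ ball (a t • w + b t) (δ / 2),
      y ∈ cthickening δ (Set.range (fun t => a t • z + b t)) := by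
    intro t w hw y hy
    refine mem_cthickening_of_dist_le y (a t • z + b t) δ _ ⟨t, rfl⟩ ?_
    have h1 : dist (a t • w + b t) (a t • z + b t) ≤ δ / 2 := by
      rw [dist_add_right, dist_eq_norm, ← smul_sub, norm_smul]
      calc ‖a t‖ * ‖w - z‖ ≤ 1 * ‖w - z‖ := by gcongr; exact ha1 t
        _ ≤ δ / 2 := by rw [one_mul, ← dist_eq_norm]; exact (mem_ball.mp hw).le
    linarith [dist_triangle y (a t • w + b t) (a t • z + b t), mem_ball.mp hy]
  have hself : ∀ t, ∀ w ∈ ball z (δ / 2), a t • w + b t ∈ U := fun t w hw =>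
    hδU (hmem t w hw _ (mem_ball_self (half_pos hδ)))
  have hbound : ∀ t, ∀ w ∈ ball z (δ / 2),
      ‖(φ t * a t) • fderiv ℂ f (a t • w + b t)‖ ≤ C * (2 * M / (δ / 2)) := by
    intro t w hw
    have h1 : ‖fderiv ℂ f (a t • w + b t)‖ ≤ 2 * M / (δ / 2) :=
      norm_fderiv_le_of_norm_le_on_ball (half_pos hδ)
        (hf.mono fun y hy => hδU (hmem t w hw y hy)) fun y hy => hM y (hmem t w hw y hy)
    have hC0 : 0 ≤ C := (norm_nonneg _).trans (hC t trivial)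
    rw [norm_smul, norm_mul]
    calc ‖φ t‖ * ‖a t‖ * ‖fderiv ℂ f (a t • w + b t)‖
        ≤ C * 1 * (2 * M / (δ / 2)) := by
          gcongr
          · exact hC t trivial
          · exact ha1 t
      _ = _ := by ring
  have hmeas : AEStronglyMeasurable (fun t => (φ t * a t) • fderiv ℂ f (a t • z + b t)) μ := by
    refine Measurable.aestronglyMeasurable ?_
    exact (hφ.mul ha).measurable.smul ((measurable_fderiv ℂ f).comp (hcont z).measurable)
  have hFc : ∀ w ∈ ball z (δ / 2), Continuous fun t => φ t * f (a t • w + b t) := fun w hw =>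
    hφ.mul (hf.continuousOn.comp_continuous (hcont w) fun t => hself t w hw)
  have hzb : z ∈ ball z (δ / 2) := mem_ball_self (half_pos hδ)
  refine ⟨Integrable.mono' (integrable_const _) hmeas (ae_of_all _ fun t => hbound t z hzb), ?_⟩
  refine hasFDerivAt_integral_of_dominated_of_fderiv_le
    (F' := fun w t => (φ t * a t) • fderiv ℂ f (a t • w + b t))
    (ball_mem_nhds z (half_pos hδ)) ?_ ?_ hmeas
    (ae_of_all _ fun t w hw => hbound t w hw) (integrable_const _) ?_
  · filter_upwards [ball_mem_nhds z (half_pos hδ)] with w hw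
    exact (hFc w hw).aestronglyMeasurable
  · have h := hFc z hzb
    obtain ⟨B, hB⟩ := isCompact_univ.exists_bound_of_continuousOn h.continuousOn
    exact Integrable.mono' (integrable_const B) h.aestronglyMeasurable
      (ae_of_all _ fun t => hB t trivial)
  · refine ae_of_all _ fun t w hw => ?_
    have h1 : HasFDerivAt f (fderiv ℂ f (a t • w + b t)) (a t • w + b t) :=
      ((hf _ (hself t w hw)).differentiableAt (hU.mem_nhds (hself t w hw))).hasFDerivAt
    have h2 : HasFDerivAt (fun w => a t • w + b t) (a t • ContinuousLinearMap.id ℂ E) w :=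
      ((hasFDerivAt_id w).const_smul (a t)).add_const _
    have h3 := (h1.comp w h2).const_mul (φ t)
    exact h3.congr_fderiv (by ext v; simp [mul_assoc])

end ParametricIntegral

/-! ### Fourier coefficients of a holomorphic function on the unit circle. -/

section Fourier

theorem norm_fourier_apply (k : ℤ) (t : UnitAddCircle) : ‖fourier k t‖ = 1 := by
  rw [fourier_apply]; exact Circle.norm_coe _

theorem fourier_natCast_apply (k : ℕ) (t : UnitAddCircle) :
    fourier (k : ℤ) t = fourier 1 t ^ k := by
  induction k with
  | zero => simp
  | succ k ih => rw [Nat.cast_succ, fourier_add, ih, pow_succ]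

theorem summable_norm_taylorCoeff {g : ℂ → ℂ} {R : ℝ} (hR : 1 < R)
    (hg : DifferentiableOn ℂ g (ball 0 R)) :
    Summable fun k : ℕ => ‖(k.factorial : ℂ)⁻¹ * iteratedDeriv k g 0‖ := by
  have h1 : (1 : ℂ) ∈ ball (0 : ℂ) R := by simpa using hR
  have := (Complex.hasSum_taylorSeries_on_ball hg h1).summable.norm
  simpa using this

theorem hasSum_taylorSeries_fourier {g : ℂ → ℂ} {R : ℝ} (hR : 1 < R)
    (hg : DifferentiableOn ℂ g (ball 0 R)) (t : UnitAddCircle) :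
    HasSum (fun k : ℕ => ((k.factorial : ℂ)⁻¹ * iteratedDeriv k g 0) * fourier (k : ℤ) t)
      (g (fourier 1 t)) := by
  have h1 : (fourier 1 t : ℂ) ∈ ball (0 : ℂ) R := by
    rw [mem_ball_zero_iff, norm_fourier_apply]; exact hR
  have := Complex.hasSum_taylorSeries_on_ball hg h1
  refine this.congr_fun fun k => ?_
  rw [fourier_natCast_apply, sub_zero, smul_eq_mul, smul_eq_mul]
  ring

theorem continuous_comp_fourier {g : ℂ → ℂ} {R : ℝ} (hR : 1 < R)
    (hg : DifferentiableOn ℂ g (ball 0 R)) :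
    Continuous fun t : UnitAddCircle => g (fourier 1 t) :=
  hg.continuousOn.comp_continuous (map_continuous _) fun t => by
    rw [mem_ball_zero_iff, norm_fourier_apply]; exact hR

/-- As `R > 1`, the Taylor series converges absolutely on the unit circle and may be integrated term
by term against any character; only the mode `k = m` survives. Hence nonnegative modes are Taylor
coefficients and negative ones vanish. -/
theorem hasSum_fourierCoeff_comp_fourier {g : ℂ → ℂ} {R : ℝ} (hR : 1 < R)
    (hg : DifferentiableOn ℂ g (ball 0 R)) (m : ℤ) :
    HasSum (fun k : ℕ => ((k.factorial : ℂ)⁻¹ * iteratedDeriv k g 0) *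
        (Pi.single (k : ℤ) 1 : ℤ → ℂ) m)
      (fourierCoeff (fun t : UnitAddCircle => g (fourier 1 t)) m) := by
  have hs := summable_norm_taylorCoeff hR hg
  have h := hasSum_integral_of_summable_integral_norm
    (μ := AddCircle.haarAddCircle (T := (1 : ℝ)))
    (F := fun (k : ℕ) (t : UnitAddCircle) => fourier (-m) t •
      (((k.factorial : ℂ)⁻¹ * iteratedDeriv k g 0) * fourier (k : ℤ) t))
    (fun k => (Continuous.integrable_of_hasCompactSupport (by fun_prop)
      (HasCompactSupport.of_compactSpace _))) (by
      refine hs.congr fun k => ?_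
      simp only [norm_smul, norm_mul _ (fourier _ _), norm_fourier_apply]
      simp)
  have h2 : ∀ t : UnitAddCircle, ∑' k : ℕ, fourier (-m) t •
      (((k.factorial : ℂ)⁻¹ * iteratedDeriv k g 0) * fourier (k : ℤ) t) =
      fourier (-m) t • g (fourier 1 t) := fun t =>
    ((hasSum_taylorSeries_fourier hR hg t).const_smul _).tsum_eq
  simp only [h2] at h
  refine h.congr_fun fun k => ?_
  rw [← fourierCoeff_fourier (T := (1 : ℝ)) (k : ℤ), fourierCoeff, ← integral_const_mul]
  refine integral_congr_ae (ae_of_all _ fun t => ?_)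
  simp only [smul_eq_mul]
  ring

theorem fourierCoeff_comp_fourier {g : ℂ → ℂ} {R : ℝ} (hR : 1 < R)
    (hg : DifferentiableOn ℂ g (ball 0 R)) (k : ℕ) :
    fourierCoeff (fun t : UnitAddCircle => g (fourier 1 t)) k =
      (k.factorial : ℂ)⁻¹ * iteratedDeriv k g 0 := by
  rw [← (hasSum_fourierCoeff_comp_fourier hR hg k).tsum_eq, tsum_eq_single k]
  · simp
  · intro j hj
    simp [hj.symm]

theorem fourierCoeff_comp_fourier_of_notMem {g : ℂ → ℂ} {R : ℝ} (hR : 1 < R)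
    (hg : DifferentiableOn ℂ g (ball 0 R)) {m : ℤ} (hm : m ∉ Set.range ((↑) : ℕ → ℤ)) :
    fourierCoeff (fun t : UnitAddCircle => g (fourier 1 t)) m = 0 := by
  rw [← (hasSum_fourierCoeff_comp_fourier hR hg m).tsum_eq]
  refine (tsum_congr fun j => ?_).trans tsum_zero
  have : m ≠ j := fun h => hm ⟨j, h.symm⟩
  simp [this]

theorem lintegral_enorm_sq_comp_fourier {g : ℂ → ℂ} {R : ℝ} (hR : 1 < R)
    (hg : DifferentiableOn ℂ g (ball 0 R)) :
    ∫⁻ t : UnitAddCircle, ‖g (fourier 1 t)‖ₑ ^ 2 ∂AddCircle.haarAddCircle =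
      ∑' k : ℕ, ‖(k.factorial : ℂ)⁻¹ * iteratedDeriv k g 0‖ₑ ^ 2 := by
  have hc := continuous_comp_fourier hR hg
  let G : C(UnitAddCircle, ℂ) := ⟨_, hc⟩
  have hL : (ContinuousMap.toLp (E := ℂ) 2 AddCircle.haarAddCircle ℂ G : UnitAddCircle → ℂ)
      =ᵐ[AddCircle.haarAddCircle] fun t => g (fourier 1 t) :=
    ContinuousMap.coeFn_toLp AddCircle.haarAddCircle G
  have h1 := hasSum_sq_fourierCoeff (ContinuousMap.toLp (E := ℂ) 2 AddCircle.haarAddCircle ℂ G)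
  have h2 : HasSum (fun i : ℤ => ‖fourierCoeff (fun t : UnitAddCircle => g (fourier 1 t)) i‖ ^ 2)
      (∫ t : UnitAddCircle, ‖g (fourier 1 t)‖ ^ 2 ∂AddCircle.haarAddCircle) := by
    rw [fourierCoeff_congr_ae hL] at h1
    convert h1 using 1
    exact integral_congr_ae (hL.mono fun t ht => by simp only [ht])
  -- The Parseval sum over `ℤ` reduces to `ℕ` because the negative modes vanish.
  rw [← Nat.cast_injective.hasSum_iff (f := fun i : ℤ =>
    ‖fourierCoeff (fun t : UnitAddCircle => g (fourier 1 t)) i‖ ^ 2) (fun m hm => by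
      rw [fourierCoeff_comp_fourier_of_notMem hR hg hm]; simp)] at h2
  simp only [Function.comp_def, fourierCoeff_comp_fourier hR hg] at h2
  have h3 : ∀ x : ℂ, ‖x‖ₑ ^ 2 = ENNReal.ofReal (‖x‖ ^ 2) := fun x => by
    rw [ENNReal.ofReal_pow (norm_nonneg _), ofReal_norm]
  simp only [h3]
  rw [← ENNReal.ofReal_tsum_of_nonneg (fun _ => by positivity) h2.summable, h2.tsum_eq,
    ofReal_integral_eq_lintegral_ofReal _ (ae_of_all _ fun _ => by positivity)]
  exact Continuous.integrable_of_hasCompactSupport (hc.norm.pow 2)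
    (HasCompactSupport.of_compactSpace _)

end Fourier

/-! ### Holomorphy of directional derivatives. -/

section Holomorphic

variable {E : Type*} [NormedAddCommGroup E] [NormedSpace ℂ E]

theorem differentiableOn_comp_line {f : E → ℂ} {z v : E} {ε r : ℝ}
    (hf : DifferentiableOn ℂ f (ball z ε)) (hr : r * ‖v‖ ≤ ε) (hv : v ≠ 0) :
    DifferentiableOn ℂ (fun c : ℂ => f (z + c • v)) (ball 0 r) := by
  refine hf.comp (by fun_prop) fun c hc => ?_
  rw [mem_ball, dist_eq_norm, add_sub_cancel_left, norm_smul]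
  have : ‖c‖ < r := by simpa using hc
  have hv' : 0 < ‖v‖ := norm_pos_iff.mpr hv
  nlinarith

/-- The directional derivatives of a holomorphic function are holomorphic. -/
theorem differentiableOn_fderiv_apply [FiniteDimensional ℂ E] [MeasurableSpace E] [BorelSpace E]
    {U : Set E} (hU : IsOpen U) {f : E → ℂ} (hf : DifferentiableOn ℂ f U) (v : E) :
    DifferentiableOn ℂ (fun z => fderiv ℂ f z v) U := by
  rcases eq_or_ne v 0 with rfl | hv
  · simp
  intro z hz
  obtain ⟨ε, hε, hεU⟩ := Metric.isOpen_iff.mp hU z hz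
  have hv' : 0 < ‖v‖ := norm_pos_iff.mpr hv
  -- With this `ρ`, for every `w` within `ε/2` of `z`, the slice `c ↦ f (w + cρv)` is holomorphic on
  -- `|c| < 2`, a disc containing the unit circle.
  set ρ : ℝ := ε / (4 * ‖v‖) with hρ
  have hρ0 : 0 < ρ := by positivity
  have hρv : ρ * ‖v‖ = ε / 4 := by rw [hρ]; field_simp
  have hρC : (ρ : ℂ) ≠ 0 := by exact_mod_cast hρ0.ne'
  -- The derivative along `ρv` is the first Taylor coefficient of the slice, hence its first Fourier
  -- coefficient: an integral of values of `f`, which can be differentiated in `w`.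
  have key : ∀ w ∈ ball z (ε / 2), fderiv ℂ f w v = (ρ : ℂ)⁻¹ *
      ∫ t : UnitAddCircle, fourier (-1) t *
        f ((1 : ℂ) • w + (fourier 1 t : ℂ) • ((ρ : ℂ) • v)) ∂AddCircle.haarAddCircle := by
    intro w hw
    have hsub : ball w (ε / 2) ⊆ U := (ball_subset_ball' (by
      have := mem_ball.mp hw; linarith)).trans hεU
    have hg : DifferentiableOn ℂ (fun c : ℂ => f (w + c • ((ρ : ℂ) • v))) (ball 0 2) :=
      differentiableOn_comp_line (hf.mono hsub)
        (by rw [norm_smul, Complex.norm_real, Real.norm_of_nonneg hρ0.le, hρv]; linarith)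
        (smul_ne_zero hρC hv)
    have h1 := fourierCoeff_comp_fourier (by norm_num) hg 1
    have hfw : HasFDerivAt f (fderiv ℂ f w) (w + (0 : ℂ) • ((ρ : ℂ) • v)) := by
      rw [zero_smul, add_zero]
      exact (hf.differentiableAt (hU.mem_nhds (hsub (mem_ball_self (half_pos hε))))).hasFDerivAt
    have h2 : HasDerivAt (fun c : ℂ => f (w + c • ((ρ : ℂ) • v)))
        (fderiv ℂ f w ((1 : ℂ) • ((ρ : ℂ) • v))) 0 :=
      hfw.comp_hasDerivAt (0 : ℂ) (((hasDerivAt_id (0 : ℂ)).smul_const ((ρ : ℂ) • v)).const_add w)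
    rw [iteratedDeriv_one, h2.deriv] at h1
    simp only [Nat.factorial_one, Nat.cast_one, inv_one, one_mul, one_smul, map_smul,
      smul_eq_mul] at h1
    rw [eq_inv_mul_iff_mul_eq₀ hρC, ← h1]
    simp [fourierCoeff]
  have hd := (hasFDerivAt_integral_comp_affine (μ := AddCircle.haarAddCircle (T := (1 : ℝ)))
    hU hf (φ := fun t : UnitAddCircle => (fourier (-1) t : ℂ)) (a := fun _ => (1 : ℂ))
    (b := fun t => (fourier 1 t : ℂ) • ((ρ : ℂ) • v)) (by fun_prop) (by fun_prop) (by fun_prop)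
    (by simp) (z := z) (fun t => hεU (by
      rw [one_smul, mem_ball, dist_eq_norm, add_sub_cancel_left, norm_smul, norm_fourier_apply,
        norm_smul, Complex.norm_real, Real.norm_of_nonneg hρ0.le, hρv]; linarith))).2
  refine DifferentiableAt.differentiableWithinAt ?_
  refine (hd.differentiableAt.const_mul (ρ : ℂ)⁻¹).congr_of_eventuallyEq ?_
  filter_upwards [ball_mem_nhds z (half_pos hε)] with w hw
  exact key w hw

end Holomorphic

/-! ### Homogeneous parts of a holomorphic function on the ball. -/

section TaylorPart

variable {n : ℕ}

/-- The homogeneous holomorphic functions of degree `k` on `ℂⁿ`. -/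
def homogeneousHolomorphic (n k : ℕ) : Submodule ℂ (Cn n → ℂ) where
  carrier := {p | Differentiable ℂ p ∧ ∀ (c : ℂ) (z : Cn n), p (c • z) = c ^ k * p z}
  zero_mem' := ⟨differentiable_const 0, by simp⟩
  add_mem' := fun hp hq => ⟨hp.1.add hq.1, fun c z => by
    rw [Pi.add_apply, hp.2, hq.2, Pi.add_apply, mul_add]⟩
  smul_mem' := fun a p hp => ⟨hp.1.const_smul a, fun c z => by
    simp only [Pi.smul_apply, smul_eq_mul, hp.2]; ring⟩

/-- The homogeneous part of degree `k` of the Taylor expansion of `f` at the origin. -/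
def taylorPart (k : ℕ) (f : Cn n → ℂ) : Cn n → ℂ :=
  fun z => (k.factorial : ℂ)⁻¹ * iteratedDeriv k (fun c : ℂ => f (c • z)) 0

theorem iteratedDeriv_comp_mul_left (k : ℕ) (c : ℂ) (g : ℂ → ℂ) :
    iteratedDeriv k (fun x => g (c * x)) = fun x => c ^ k * iteratedDeriv k g (c * x) := by
  induction k with
  | zero => simp
  | succ k ih =>
    funext x
    rw [iteratedDeriv_succ, ih, deriv_const_mul_field']
    beta_reduce
    rw [deriv_comp_mul_left, iteratedDeriv_succ, smul_eq_mul, pow_succ, mul_assoc]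

theorem taylorPart_smul (k : ℕ) (f : Cn n → ℂ) (c : ℂ) (z : Cn n) :
    taylorPart k f (c • z) = c ^ k * taylorPart k f z := by
  have h : (fun x : ℂ => f (x • c • z)) = fun x => (fun y : ℂ => f (y • z)) (c * x) := by
    funext x; simp only [smul_smul, mul_comm]
  simp only [taylorPart]
  rw [h, iteratedDeriv_comp_mul_left k c fun y => f (y • z)]
  simp only [mul_zero]
  ring

theorem differentiableOn_slice {f : Cn n → ℂ} (hf : DifferentiableOn ℂ f (unitBall n)) {z : Cn n}
    (hz : z ∈ unitBall n) :
    ∃ R, 1 < R ∧ DifferentiableOn ℂ (fun c : ℂ => f (c • z)) (ball 0 R) := by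
  have hz1 : ‖z‖ < 1 := by simpa using hz
  rcases eq_or_ne z 0 with rfl | hz0
  · exact ⟨2, by norm_num, by simp⟩
  · have hpos : 0 < ‖z‖ := norm_pos_iff.mpr hz0
    refine ⟨‖z‖⁻¹, (one_lt_inv₀ hpos).mpr hz1, ?_⟩
    have := differentiableOn_comp_line (z := 0) (r := ‖z‖⁻¹) hf
      (by rw [inv_mul_cancel₀ hpos.ne']) hz0
    simpa using this

theorem continuous_slice {f : Cn n → ℂ} (hf : DifferentiableOn ℂ f (unitBall n)) {z : Cn n}
    (hz : z ∈ unitBall n) : Continuous fun t : UnitAddCircle => f ((fourier 1 t : ℂ) • z) := by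
  obtain ⟨R, hR, hg⟩ := differentiableOn_slice hf hz
  exact continuous_comp_fourier hR hg

theorem fourierCoeff_slice {f : Cn n → ℂ} (hf : DifferentiableOn ℂ f (unitBall n)) {z : Cn n}
    (hz : z ∈ unitBall n) (k : ℕ) :
    fourierCoeff (fun t : UnitAddCircle => f ((fourier 1 t : ℂ) • z)) k = taylorPart k f z := by
  obtain ⟨R, hR, hg⟩ := differentiableOn_slice hf hz
  exact fourierCoeff_comp_fourier hR hg k

theorem lintegral_enorm_sq_slice {f : Cn n → ℂ} (hf : DifferentiableOn ℂ f (unitBall n)) {z : Cn n}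
    (hz : z ∈ unitBall n) :
    ∫⁻ t : UnitAddCircle, ‖f ((fourier 1 t : ℂ) • z)‖ₑ ^ 2 ∂AddCircle.haarAddCircle =
      ∑' k : ℕ, ‖taylorPart k f z‖ₑ ^ 2 := by
  obtain ⟨R, hR, hg⟩ := differentiableOn_slice hf hz
  exact lintegral_enorm_sq_comp_fourier hR hg

theorem fourier_smul_mem_unitBall {z : Cn n} (hz : z ∈ unitBall n) (k : ℤ) (t : UnitAddCircle) :
    (fourier k t : ℂ) • z ∈ unitBall n := by
  simpa [norm_smul, norm_fourier_apply, -fourier_apply] using hz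

/-- A point of `ℂⁿ` is a multiple of a point of the unit ball. -/
theorem exists_smul_mem_unitBall (z : Cn n) : ∃ c : ℂ, c ≠ 0 ∧ ∃ w ∈ unitBall n, z = c • w := by
  have h : (0 : ℝ) < ‖z‖ + 1 := by positivity
  have hC : ((‖z‖ + 1 : ℝ) : ℂ) ≠ 0 := by exact_mod_cast h.ne'
  refine ⟨((‖z‖ + 1 : ℝ) : ℂ), hC, ((‖z‖ + 1 : ℝ) : ℂ)⁻¹ • z, ?_, (smul_inv_smul₀ hC z).symm⟩
  rw [mem_ball_zero_iff, norm_smul, norm_inv, Complex.norm_real, Real.norm_of_nonneg h.le,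
    inv_mul_lt_iff₀ h]
  linarith

/-- Identities between homogeneous functions need checking only on the ball, where homogeneous parts
are Fourier coefficients of slices. -/
theorem eq_of_eqOn_unitBall {k : ℕ} {p q : Cn n → ℂ}
    (hp : ∀ (c : ℂ) (z : Cn n), p (c • z) = c ^ k * p z)
    (hq : ∀ (c : ℂ) (z : Cn n), q (c • z) = c ^ k * q z) (h : Set.EqOn p q (unitBall n)) :
    p = q := by
  funext z
  obtain ⟨c, -, w, hw, rfl⟩ := exists_smul_mem_unitBall z
  rw [hp, hq, h hw]

theorem hasFDerivAt_taylorPart {f : Cn n → ℂ} (hf : DifferentiableOn ℂ f (unitBall n)) {z : Cn n}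
    (hz : z ∈ unitBall n) (k : ℕ) :
    Integrable (fun t : UnitAddCircle => (fourier (-(k : ℤ)) t * fourier 1 t : ℂ) •
      fderiv ℂ f ((fourier 1 t : ℂ) • z)) AddCircle.haarAddCircle ∧
    HasFDerivAt (taylorPart k f)
      (∫ t : UnitAddCircle, (fourier (-(k : ℤ)) t * fourier 1 t : ℂ) •
        fderiv ℂ f ((fourier 1 t : ℂ) • z) ∂AddCircle.haarAddCircle) z := by
  have h := hasFDerivAt_integral_comp_affine (μ := AddCircle.haarAddCircle (T := (1 : ℝ)))
    isOpen_ball hf (φ := fun t : UnitAddCircle => (fourier (-(k : ℤ)) t : ℂ))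
    (a := fun t => (fourier 1 t : ℂ)) (b := fun _ => 0) (by fun_prop) (by fun_prop) (by fun_prop)
    (fun t => (norm_fourier_apply 1 t).le) (z := z) (fun t => by
      rw [add_zero]; exact fourier_smul_mem_unitBall hz 1 t)
  simp only [add_zero] at h
  refine ⟨h.1, h.2.congr_of_eventuallyEq ?_⟩
  filter_upwards [isOpen_ball.mem_nhds hz] with w hw
  rw [← fourierCoeff_slice hf hw]
  rfl

theorem taylorPart_mem {f : Cn n → ℂ} (hf : DifferentiableOn ℂ f (unitBall n)) (k : ℕ) :
    taylorPart k f ∈ homogeneousHolomorphic n k := by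
  refine ⟨fun z => ?_, taylorPart_smul k f⟩
  obtain ⟨c, hc, w, hw, rfl⟩ := exists_smul_mem_unitBall z
  have h1 : DifferentiableAt ℂ (taylorPart k f) w := (hasFDerivAt_taylorPart hf hw k).2.differentiableAt
  -- Differentiability is known only inside the ball; homogeneity transports it to every other point
  -- by scaling.
  have h2 : taylorPart k f = fun y => c ^ k * taylorPart k f (c⁻¹ • y) := by
    funext y
    rw [taylorPart_smul, ← mul_assoc, ← mul_pow, mul_inv_cancel₀ hc, one_pow, one_mul]
  rw [h2]
  refine DifferentiableAt.const_mul ?_ _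
  refine DifferentiableAt.comp (c • w) (g := taylorPart k f) ?_ (by fun_prop)
  rwa [inv_smul_smul₀ hc]

theorem taylorPart_congr {f g : Cn n → ℂ} (h : Set.EqOn f g (unitBall n)) (k : ℕ) :
    taylorPart k f = taylorPart k g := by
  funext z
  have : (fun c : ℂ => f (c • z)) =ᶠ[𝓝 0] fun c => g (c • z) := by
    have hc : ContinuousAt (fun c : ℂ => c • z) 0 := by fun_prop
    filter_upwards [hc.preimage_mem_nhds (by
      rw [zero_smul]; exact ball_mem_nhds 0 one_pos)] with c hc
    exact h hc
  rw [taylorPart, taylorPart, this.iteratedDeriv_eq]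

theorem taylorPart_add {f g : Cn n → ℂ} (hf : DifferentiableOn ℂ f (unitBall n))
    (hg : DifferentiableOn ℂ g (unitBall n)) (k : ℕ) :
    taylorPart k (f + g) = taylorPart k f + taylorPart k g := by
  refine eq_of_eqOn_unitBall (taylorPart_smul k _) (fun c z => ?_) fun z hz => ?_
  · simp only [Pi.add_apply, taylorPart_smul, mul_add]
  · rw [Pi.add_apply, ← fourierCoeff_slice hf hz, ← fourierCoeff_slice hg hz,
      ← fourierCoeff_slice (hf.add hg) hz]
    exact congrFun (fourierCoeff.add
      ((continuous_slice hf hz).integrable_of_hasCompactSupport (HasCompactSupport.of_compactSpace _))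
      ((continuous_slice hg hz).integrable_of_hasCompactSupport
        (HasCompactSupport.of_compactSpace _))) _

theorem taylorPart_const_smul {f : Cn n → ℂ} (hf : DifferentiableOn ℂ f (unitBall n)) (a : ℂ)
    (k : ℕ) : taylorPart k (a • f) = a • taylorPart k f := by
  refine eq_of_eqOn_unitBall (taylorPart_smul k _) (fun c z => ?_) fun z hz => ?_
  · simp only [Pi.smul_apply, taylorPart_smul, smul_eq_mul]; ring
  · rw [Pi.smul_apply, ← fourierCoeff_slice hf hz, ← fourierCoeff_slice (hf.const_smul a) hz]
    exact fourierCoeff.const_smul _ a _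

theorem taylorPart_of_mem {k : ℕ} {p : Cn n → ℂ} (hp : p ∈ homogeneousHolomorphic n k) (j : ℕ) :
    taylorPart j p = if j = k then p else 0 := by
  refine eq_of_eqOn_unitBall (taylorPart_smul j _) (fun c z => ?_) fun z hz => ?_
  · split_ifs with h
    · rw [h, hp.2]
    · simp
  · rw [← fourierCoeff_slice hp.1.differentiableOn hz]
    have h1 : (fun t : UnitAddCircle => p ((fourier 1 t : ℂ) • z)) =
        p z • ⇑(fourier (k : ℤ) : C(UnitAddCircle, ℂ)) := by
      funext t
      rw [hp.2, Pi.smul_apply, fourier_natCast_apply, smul_eq_mul, mul_comm]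
    rw [h1, fourierCoeff.const_smul, fourierCoeff_fourier]
    by_cases h : j = k
    · simp [h]
    · simp [h]

theorem differentiableOn_complexPartial {U : Set (Cn n)} (hU : IsOpen U) {f : Cn n → ℂ}
    (hf : DifferentiableOn ℂ f U) (i : Fin n) : DifferentiableOn ℂ (complexPartial i f) U :=
  differentiableOn_fderiv_apply hU hf _

theorem fderiv_apply_mem {k : ℕ} {p : Cn n → ℂ} (hp : p ∈ homogeneousHolomorphic n (k + 1))
    (v : Cn n) : (fun z => fderiv ℂ p z v) ∈ homogeneousHolomorphic n k := by
  have hd : DifferentiableOn ℂ (fun z => fderiv ℂ p z v) Set.univ :=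
    differentiableOn_fderiv_apply isOpen_univ hp.1.differentiableOn v
  have hd' := differentiableOn_univ.mp hd
  have hne : ∀ (c : ℂ), c ≠ 0 → ∀ (z : Cn n),
      fderiv ℂ p (c • z) v = c ^ k * fderiv ℂ p z v := by
    intro c hc z
    have h1 : HasFDerivAt (fun y => p (c • y)) ((fderiv ℂ p (c • z)).comp
        (c • ContinuousLinearMap.id ℂ (Cn n))) z :=
      (hp.1 (c • z)).hasFDerivAt.comp z ((hasFDerivAt_id z).const_smul c)
    have h2 : HasFDerivAt (fun y => p (c • y)) (c ^ (k + 1) • fderiv ℂ p z) z := by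
      simp only [hp.2]
      exact (hp.1 z).hasFDerivAt.const_mul _
    have h3 := congrArg (fun L => L v) (h1.unique h2)
    simp only [ContinuousLinearMap.comp_apply, _root_.smul_apply,
      ContinuousLinearMap.id_apply, map_smul, smul_eq_mul, pow_succ] at h3
    apply mul_left_cancel₀ hc
    rw [h3]; ring
  refine ⟨hd', fun c z => ?_⟩
  -- Differentiating `p (c • z) = c ^ (k+1) * p z` leaves a factor `c` to cancel, so `c = 0` is
  -- recovered by continuity.
  have hcl : Continuous fun c : ℂ => fderiv ℂ p (c • z) v :=
    hd'.continuous.comp (f := fun c : ℂ => c • z) (by fun_prop)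
  have hcr : Continuous fun c : ℂ => c ^ k * fderiv ℂ p z v := by fun_prop
  exact congrFun (hcl.ext_on (dense_compl_singleton (0 : ℂ)) hcr fun c hc => hne c hc z) c

theorem complexPartial_mem {k : ℕ} {p : Cn n → ℂ} (hp : p ∈ homogeneousHolomorphic n (k + 1))
    (i : Fin n) : complexPartial i p ∈ homogeneousHolomorphic n k :=
  fderiv_apply_mem hp _

theorem eq_const_of_mem_zero {p : Cn n → ℂ} (hp : p ∈ homogeneousHolomorphic n 0) :
    p = fun _ => p 0 := by
  funext z
  have := hp.2 0 z
  rw [zero_smul, pow_zero, one_mul] at this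
  exact this.symm

theorem fderiv_of_mem_zero {p : Cn n → ℂ} (hp : p ∈ homogeneousHolomorphic n 0) (z : Cn n) :
    fderiv ℂ p z = 0 := by
  rw [eq_const_of_mem_zero hp]
  exact fderiv_const_apply _

/-- Euler's identity for homogeneous functions. -/
theorem fderiv_apply_self_of_mem {k : ℕ} {p : Cn n → ℂ} (hp : p ∈ homogeneousHolomorphic n k)
    (z : Cn n) : fderiv ℂ p z z = k * p z := by
  have h1 : HasDerivAt (fun c : ℂ => p (c • z)) (fderiv ℂ p ((1 : ℂ) • z) ((1 : ℂ) • z)) 1 :=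
    (hp.1 ((1 : ℂ) • z)).hasFDerivAt.comp_hasDerivAt (1 : ℂ) ((hasDerivAt_id (1 : ℂ)).smul_const z)
  have h2 : HasDerivAt (fun c : ℂ => p (c • z)) ((k * (1 : ℂ) ^ (k - 1)) * p z) 1 := by
    simp only [hp.2]
    exact (hasDerivAt_pow k (1 : ℂ)).mul_const _
  simpa using h1.unique h2

theorem sum_coord_mul_complexPartial {k : ℕ} {p : Cn n → ℂ}
    (hp : p ∈ homogeneousHolomorphic n k) (z : Cn n) :
    ∑ i, z i * complexPartial i p z = k * p z := by
  rw [← fderiv_apply_self_of_mem hp z]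
  conv_rhs => rw [← (EuclideanSpace.basisFun (Fin n) ℂ).sum_repr z]
  rw [map_sum]
  refine Finset.sum_congr rfl fun i _ => ?_
  rw [map_smul, (EuclideanSpace.basisFun (Fin n) ℂ).sum_repr z]
  simp [complexPartial]

/-- Differentiating the slice integral multiplies the integrand by one character, so the mode
`-(k+1)` becomes `-k`. -/
theorem taylorPart_complexPartial {f : Cn n → ℂ} (hf : DifferentiableOn ℂ f (unitBall n))
    (i : Fin n) (k : ℕ) :
    taylorPart k (complexPartial i f) = complexPartial i (taylorPart (k + 1) f) := by
  refine eq_of_eqOn_unitBall (taylorPart_smul k _)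
    (complexPartial_mem (taylorPart_mem hf (k + 1)) i).2 fun z hz => ?_
  obtain ⟨h1, h2⟩ := hasFDerivAt_taylorPart hf hz (k + 1)
  rw [← fourierCoeff_slice (differentiableOn_complexPartial isOpen_ball hf i) hz, complexPartial,
    h2.fderiv, ContinuousLinearMap.integral_apply h1]
  refine integral_congr_ae (ae_of_all _ fun t => ?_)
  simp only [_root_.smul_apply, complexPartial, smul_eq_mul]
  rw [← fourier_add]
  congr 3
  push_cast
  ring

end TaylorPart

/-! ### Rotation invariance, Parseval on the sphere and polar coordinates. -/

section SphereMeasure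

variable {n : ℕ}

theorem finrank_real_Cn (n : ℕ) : Module.finrank ℝ (Cn n) = 2 * n := by
  rw [finrank_real_of_complex, finrank_euclideanSpace_fin]

theorem nontrivial_Cn [NeZero n] : Nontrivial (Cn n) :=
  Module.nontrivial_of_finrank_pos (R := ℂ) (by
    rw [finrank_euclideanSpace_fin]; exact Nat.pos_of_ne_zero (NeZero.ne n))

theorem toSphere_univ_ne_zero [NeZero n] : (volume : Measure (Cn n)).toSphere Set.univ ≠ 0 := by
  have := nontrivial_Cn (n := n)
  exact (Measure.measure_univ_ne_zero).mpr (Measure.toSphere_ne_zero _)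

instance sphereMeasure.isProbabilityMeasure [NeZero n] : IsProbabilityMeasure (sphereMeasure n) :=
  ⟨by
    rw [sphereMeasure, Measure.smul_apply, smul_eq_mul]
    exact ENNReal.inv_mul_cancel toSphere_univ_ne_zero (measure_ne_top _ _)⟩

theorem toSphere_eq_smul_sphereMeasure [NeZero n] : (volume : Measure (Cn n)).toSphere =
    (volume : Measure (Cn n)).toSphere Set.univ • sphereMeasure n := by
  rw [sphereMeasure, smul_smul, ENNReal.mul_inv_cancel toSphere_univ_ne_zero (measure_ne_top _ _),
    one_smul]

/-- Multiplication by a complex number of modulus one on `ℂⁿ`. -/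
def unimodularIsometry (n : ℕ) (u : Circle) : Cn n ≃ₗᵢ[ℝ] Cn n where
  toFun z := (u : ℂ) • z
  invFun z := ((u⁻¹ : Circle) : ℂ) • z
  left_inv z := by simp [smul_smul]
  right_inv z := by simp [smul_smul]
  map_add' := smul_add _
  map_smul' c z := smul_comm _ _ _
  norm_map' z := by
    change ‖(u : ℂ) • z‖ = ‖z‖
    rw [norm_smul, Circle.norm_coe, one_mul]

/-- Multiplication by a complex number of modulus one on the unit sphere. -/
def sphereRotation (u : Circle) (ζ : sphere (0 : Cn n) 1) : sphere (0 : Cn n) 1 :=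
  ⟨(u : ℂ) • (ζ : Cn n), by
    rw [mem_sphere_zero_iff_norm, norm_smul, Circle.norm_coe, one_mul, norm_eq_of_mem_sphere]⟩

theorem continuous_sphereRotation (u : Circle) :
    Continuous (sphereRotation u : sphere (0 : Cn n) 1 → _) := by
  unfold sphereRotation; fun_prop

-- The surface measure of a set is a multiple of the volume of the cone over it, and multiplication
-- by a unimodular scalar is a linear isometry carrying cones to cones.
open scoped Pointwise in
theorem measurePreserving_sphereRotation (u : Circle) :
    MeasurePreserving (sphereRotation u) (sphereMeasure n) (sphereMeasure n) := by
  refine MeasurePreserving.smul_measure ⟨(continuous_sphereRotation u).measurable, ?_⟩ _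
  ext s hs
  have hm : Measurable (sphereRotation u : sphere (0 : Cn n) 1 → _) :=
    (continuous_sphereRotation u).measurable
  rw [Measure.map_apply hm hs, Measure.toSphere_apply' _ (hm hs), Measure.toSphere_apply' _ hs]
  congr 1
  have hpre : (Set.Ioo (0 : ℝ) 1 • (Subtype.val '' (sphereRotation u ⁻¹' s)) : Set (Cn n)) =
      unimodularIsometry n u ⁻¹' (Set.Ioo (0 : ℝ) 1 • (Subtype.val '' s)) := by
    ext z
    simp only [Set.mem_smul, Set.mem_image, Set.mem_preimage]
    constructor
    · rintro ⟨r, hr, _, ⟨ζ, hζ, rfl⟩, rfl⟩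
      exact ⟨r, hr, _, ⟨_, hζ, rfl⟩, smul_comm _ _ _⟩
    · rintro ⟨r, hr, _, ⟨ζ, hζ, rfl⟩, h⟩
      refine ⟨r, hr, _, ⟨sphereRotation u⁻¹ ζ, ?_, rfl⟩, ?_⟩
      · have : sphereRotation u (sphereRotation u⁻¹ ζ) = ζ := by
          ext1; simp [sphereRotation, smul_smul]
        rwa [this]
      · have h2 : r • (ζ : Cn n) = (u : ℂ) • z := h
        change r • ((u⁻¹ : Circle) : ℂ) • (ζ : Cn n) = z
        rw [smul_comm, h2, smul_smul]
        simp
  rw [hpre]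
  exact (unimodularIsometry n u).measurePreserving.measure_preimage_emb
    (unimodularIsometry n u).toHomeomorph.measurableEmbedding _

/-- The mean square of a function over the unit sphere. -/
def sphereSqNorm (p : Cn n → ℂ) : ℝ≥0∞ := ∫⁻ ζ : sphere (0 : Cn n) 1, ‖p ζ‖ₑ ^ 2 ∂(sphereMeasure n)

theorem lintegral_sphere_eq_lintegral_circle {h : sphere (0 : Cn n) 1 → ℝ≥0∞} [NeZero n]
    (hh : Continuous h) :
    ∫⁻ ζ, h ζ ∂(sphereMeasure n) =
      ∫⁻ ζ, ∫⁻ t : UnitAddCircle, h (sphereRotation (AddCircle.toCircle t) ζ)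
        ∂AddCircle.haarAddCircle ∂(sphereMeasure n) := by
  have hc : Continuous fun x : sphere (0 : Cn n) 1 × UnitAddCircle =>
      sphereRotation (AddCircle.toCircle x.2) x.1 := by
    unfold sphereRotation
    have := AddCircle.continuous_toCircle (T := (1 : ℝ))
    fun_prop
  rw [lintegral_lintegral_swap (f := fun ζ t => h (sphereRotation (AddCircle.toCircle t) ζ))
    (hh.comp hc).measurable.aemeasurable]
  simp_rw [(measurePreserving_sphereRotation _).lintegral_comp hh.measurable]
  simp

/-- Averaging first over the circle through each `ζ` allows one-variable Parseval to be applied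
slice by slice; orthogonality of different degrees on the sphere is thus never needed separately. -/
theorem lintegral_sphere_dilate [NeZero n] {f : Cn n → ℂ}
    (hf : DifferentiableOn ℂ f (unitBall n)) {r : ℝ} (hr : r ∈ Set.Ioo (0 : ℝ) 1) :
    ∫⁻ ζ : sphere (0 : Cn n) 1, ‖f (r • (ζ : Cn n))‖ₑ ^ 2 ∂(sphereMeasure n) =
      ∑' k : ℕ, ENNReal.ofReal (r ^ (2 * k)) * sphereSqNorm (taylorPart k f) := by
  have hcont : Continuous fun ζ : sphere (0 : Cn n) 1 => f (r • (ζ : Cn n)) :=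
    hf.continuousOn.comp_continuous (by fun_prop) fun ζ => smul_mem_unitBall hr ζ
  rw [lintegral_sphere_eq_lintegral_circle (h := fun ζ : sphere (0 : Cn n) 1 => ‖f (r • (ζ : Cn n))‖ₑ ^ 2)
    ((ENNReal.continuous_pow 2).comp hcont.enorm)]
  have h1 : ∀ ζ : sphere (0 : Cn n) 1, ∫⁻ t : UnitAddCircle,
      ‖f (r • (sphereRotation (AddCircle.toCircle t) ζ : Cn n))‖ₑ ^ 2 ∂AddCircle.haarAddCircle =
      ∑' k : ℕ, ENNReal.ofReal (r ^ (2 * k)) * ‖taylorPart k f ζ‖ₑ ^ 2 := by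
    intro ζ
    have h2 := lintegral_enorm_sq_slice hf (smul_mem_unitBall hr ζ)
    have h3 : ∀ t : UnitAddCircle, r • (sphereRotation (AddCircle.toCircle t) ζ : Cn n) =
        (fourier 1 t : ℂ) • r • (ζ : Cn n) := fun t => by
      rw [fourier_one, smul_comm]; rfl
    simp only [h3]
    rw [h2]
    refine tsum_congr fun k => ?_
    have h4 : r • (ζ : Cn n) = (r : ℂ) • (ζ : Cn n) := (Complex.coe_smul r _).symm
    rw [h4, taylorPart_smul, enorm_mul, mul_pow, enorm_pow, ← pow_mul, mul_comm k 2]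
    congr 1
    rw [ENNReal.ofReal_pow hr.1.le, ← ofReal_norm, Complex.norm_real, Real.norm_of_nonneg hr.1.le]
  simp only [h1]
  rw [lintegral_tsum]
  · refine tsum_congr fun k => ?_
    have hm : Measurable fun ζ : sphere (0 : Cn n) 1 => ‖taylorPart k f ζ‖ₑ ^ 2 := by
      exact ((ENNReal.continuous_pow 2).comp
        ((taylorPart_mem hf k).1.continuous.comp continuous_subtype_val).enorm).measurable
    rw [lintegral_const_mul _ hm, sphereSqNorm]
  · intro k
    exact (((ENNReal.continuous_pow 2).comp
      ((taylorPart_mem hf k).1.continuous.comp continuous_subtype_val).enorm).measurable.const_mul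
        _).aemeasurable

/-- Monotone convergence as `r → 1`: each finite partial sum converges, and `0 < r < 1` only
decreases the terms. -/
theorem iSup_tsum_ofReal_pow_mul (a : ℕ → ℝ≥0∞) :
    ⨆ r ∈ Set.Ioo (0 : ℝ) 1, ∑' k : ℕ, ENNReal.ofReal (r ^ (2 * k)) * a k = ∑' k, a k := by
  refine le_antisymm (iSup₂_le fun r hr => ENNReal.tsum_le_tsum fun k => ?_) ?_
  · refine mul_le_of_le_one_left' ?_
    rw [ENNReal.ofReal_le_one]
    exact pow_le_one₀ hr.1.le hr.2.le
  · rw [ENNReal.tsum_eq_iSup_sum]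
    refine iSup_le fun s => ?_
    have ht : Tendsto (fun r : ℝ => ∑ k ∈ s, ENNReal.ofReal (r ^ (2 * k)) * a k) (𝓝[<] 1)
        (𝓝 (∑ k ∈ s, a k)) := by
      refine tendsto_finsetSum _ fun k _ => ?_
      have h1 : Tendsto (fun r : ℝ => ENNReal.ofReal (r ^ (2 * k))) (𝓝[<] 1) (𝓝 1) := by
        have : Continuous fun r : ℝ => ENNReal.ofReal (r ^ (2 * k)) :=
          ENNReal.continuous_ofReal.comp (by fun_prop)
        have := (this.tendsto 1).mono_left (nhdsWithin_le_nhds (s := Set.Iio 1))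
        simpa using this
      simpa using ENNReal.Tendsto.mul_const (b := a k) h1 (Or.inl one_ne_zero)
    refine le_of_tendsto ht ?_
    filter_upwards [Ioo_mem_nhdsLT (zero_lt_one (α := ℝ))] with r hr
    exact (ENNReal.sum_le_tsum s).trans
      (le_iSup₂ (f := fun (r : ℝ) (_ : r ∈ Set.Ioo (0 : ℝ) 1) =>
        ∑' k : ℕ, ENNReal.ofReal (r ^ (2 * k)) * a k) r hr)

theorem hardyENorm_sq [NeZero n] {f : unitBall n → ℂ} (hf : IsHolomorphicOnBall f) :
    hardyENorm f ^ 2 = ∑' k, sphereSqNorm (taylorPart k (zeroExt f)) := by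
  have h1 : hardyENorm f = (⨆ r ∈ Set.Ioo (0 : ℝ) 1,
      ∫⁻ ζ : sphere (0 : Cn n) 1, ‖zeroExt f (r • (ζ : Cn n))‖ₑ ^ 2 ∂(sphereMeasure n))
        ^ (1 / 2 : ℝ) := by
    rw [hardyENorm]
    -- The square root is an order isomorphism of `[0,∞]`, so it commutes with the supremum.
    simp only [← ENNReal.orderIsoRpow_apply (1 / 2 : ℝ) (by norm_num), OrderIso.map_iSup]
  rw [h1, ← ENNReal.rpow_natCast, ← ENNReal.rpow_mul]
  norm_num
  rw [← iSup_tsum_ofReal_pow_mul]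
  exact iSup_congr fun r => iSup_congr fun hr => lintegral_sphere_dilate hf hr

theorem lintegral_polar [NeZero n] {F : Cn n → ℝ≥0∞} (hF : Measurable F) :
    ∫⁻ z, F z = (volume : Measure (Cn n)).toSphere Set.univ *
      ∫⁻ t in Set.Ioi (0 : ℝ), ENNReal.ofReal (t ^ (2 * n - 1)) *
        ∫⁻ ζ : sphere (0 : Cn n) 1, F (t • (ζ : Cn n)) ∂(sphereMeasure n) := by
  have := nontrivial_Cn (n := n)
  have hmp := (volume : Measure (Cn n)).measurePreserving_homeomorphUnitSphereProd
  have h0 : ∫⁻ z, F z = ∫⁻ z : ({(0 : Cn n)}ᶜ : Set (Cn n)), F (z : Cn n) ∂(volume.comap Subtype.val) := by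
    rw [lintegral_subtype_comap (measurableSet_singleton _).compl, restrict_compl_singleton]
  have hG : Measurable fun x : sphere (0 : Cn n) 1 × Set.Ioi (0 : ℝ) =>
      F ((x.2 : ℝ) • (x.1 : Cn n)) := by fun_prop
  have h1 : ∫⁻ z : ({(0 : Cn n)}ᶜ : Set (Cn n)), F (z : Cn n) ∂(volume.comap Subtype.val) =
      ∫⁻ x : sphere (0 : Cn n) 1 × Set.Ioi (0 : ℝ), F ((x.2 : ℝ) • (x.1 : Cn n))
        ∂((volume : Measure (Cn n)).toSphere.prod
          (Measure.volumeIoiPow (Module.finrank ℝ (Cn n) - 1))) := by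
    rw [← hmp.lintegral_comp hG]
    refine lintegral_congr fun z => ?_
    congr 1
    have hz : ‖(z : Cn n)‖ ≠ 0 := norm_ne_zero_iff.mpr z.2
    simp [smul_smul, hz]
  rw [h0, h1, lintegral_prod_symm _ hG.aemeasurable, finrank_real_Cn, Measure.volumeIoiPow,
    lintegral_withDensity_eq_lintegral_mul _ (by fun_prop) hG.lintegral_prod_left',
    toSphere_eq_smul_sphereMeasure]
  simp only [Pi.mul_apply, lintegral_smul_measure, Measure.smul_apply, smul_eq_mul, measure_univ,
    mul_one]
  rw [lintegral_subtype_comap measurableSet_Ioi fun t : ℝ => ENNReal.ofReal (t ^ (2 * n - 1)) *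
      ((volume : Measure (Cn n)).toSphere Set.univ *
        ∫⁻ ζ : sphere (0 : Cn n) 1, F (t • (ζ : Cn n)) ∂(sphereMeasure n)),
    ← lintegral_const_mul' _ _ (measure_ne_top _ _)]
  refine lintegral_congr fun t => ?_
  ring

end SphereMeasure

/-! ### Gaussian integrals and the gradient identity for homogeneous functions. -/

section Fock

open ComplexConjugate

variable {n : ℕ}

theorem exists_norm_le_of_mem {k : ℕ} {p : Cn n → ℂ} (hp : p ∈ homogeneousHolomorphic n k) :
    ∃ C, ∀ z, ‖p z‖ ≤ C * ‖z‖ ^ k := by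
  obtain ⟨C, hC⟩ := (isCompact_closedBall (0 : Cn n) 1).exists_bound_of_continuousOn
    hp.1.continuous.continuousOn
  refine ⟨C, fun z => ?_⟩
  have hz : z = ((‖z‖ : ℝ) : ℂ) • (((‖z‖⁻¹ : ℝ) : ℂ) • z) := by
    rcases eq_or_ne z 0 with rfl | h
    · simp
    · rw [smul_smul, ← Complex.ofReal_mul, mul_inv_cancel₀ (norm_ne_zero_iff.mpr h)]
      simp
  have hmem : ((‖z‖⁻¹ : ℝ) : ℂ) • z ∈ closedBall (0 : Cn n) 1 := by
    rw [mem_closedBall_zero_iff, norm_smul, Complex.norm_real, norm_inv, norm_norm]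
    exact inv_mul_le_one
  rw [hz, hp.2, norm_mul, norm_pow, Complex.norm_real, norm_norm, ← hz, mul_comm]
  gcongr
  exact hC _ hmem

theorem integrable_mul_gaussian [NeZero n] {u : Cn n → ℂ} (hu : Continuous u) {C : ℝ} {m : ℕ}
    (hb : ∀ z, ‖u z‖ ≤ C * ‖z‖ ^ m) :
    Integrable fun z => u z * (Real.exp (-‖z‖ ^ 2) : ℂ) := by
  have := nontrivial_Cn (n := n)
  have h1 : Integrable fun z : Cn n => ‖z‖ ^ m * Real.exp (-‖z‖ ^ 2) := by
    have h2 := integrable_fun_norm_addHaar (volume : Measure (Cn n))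
      (f := fun t : ℝ => t ^ m * Real.exp (-t ^ 2))
    rw [h2]
    have h3 := (integrable_rpow_mul_exp_neg_mul_sq (b := 1) one_pos
      (s := ((Module.finrank ℝ (Cn n) - 1 + m : ℕ) : ℝ)) (by
        have : (0 : ℝ) ≤ ((Module.finrank ℝ (Cn n) - 1 + m : ℕ) : ℝ) := Nat.cast_nonneg _
        linarith)).integrableOn (s := Set.Ioi 0)
    refine h3.congr (ae_of_all _ fun t => ?_)
    simp only [Real.rpow_natCast, smul_eq_mul, pow_add]
    ring_nf
  refine (h1.const_mul C).mono' (by fun_prop) (ae_of_all _ fun z => ?_)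
  rw [norm_mul, Complex.norm_real, Real.norm_of_nonneg (Real.exp_pos _).le, ← mul_assoc]
  gcongr
  exact hb z

/-- The real derivative of `conj q · exp(-|z|²)` for holomorphic `q`. -/
def fderivConjMulGaussian (q : Cn n → ℂ) (z : Cn n) : Cn n →L[ℝ] ℂ :=
  conj (q z) • ((-(2 * Real.exp (-‖z‖ ^ 2)) : ℝ) • (Complex.ofRealCLM ∘L innerSL ℝ z)) +
    (Real.exp (-‖z‖ ^ 2) : ℂ) • (Complex.conjCLE.toContinuousLinearMap ∘L
      (fderiv ℂ q z).restrictScalars ℝ)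

theorem hasFDerivAt_conj_mul_gaussian {q : Cn n → ℂ} (hq : Differentiable ℂ q) (z : Cn n) :
    HasFDerivAt (fun z => conj (q z) * (Real.exp (-‖z‖ ^ 2) : ℂ))
      (fderivConjMulGaussian q z) z := by
  have h1 : HasFDerivAt (fun z => conj (q z)) (Complex.conjCLE.toContinuousLinearMap ∘L
      (fderiv ℂ q z).restrictScalars ℝ) z :=
    Complex.conjCLE.toContinuousLinearMap.hasFDerivAt.comp z
      ((hq z).hasFDerivAt.restrictScalars ℝ)
  have h2 : HasFDerivAt (fun z : Cn n => Real.exp (-‖z‖ ^ 2))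
      (Real.exp (-‖z‖ ^ 2) • -((2 : ℕ) • (innerSL ℝ z : Cn n →L[ℝ] ℝ))) z :=
    (hasStrictFDerivAt_norm_sq z).hasFDerivAt.neg.exp
  have h3 := h1.mul (Complex.ofRealCLM.hasFDerivAt.comp z h2)
  refine h3.congr_fderiv ?_
  ext v
  simp [fderivConjMulGaussian]
  left
  ring

theorem exists_norm_fderiv_apply_le {k : ℕ} {p : Cn n → ℂ}
    (hp : p ∈ homogeneousHolomorphic n k) (v : Cn n) :
    Continuous (fun z => fderiv ℂ p z v) ∧ ∃ C m, ∀ z, ‖fderiv ℂ p z v‖ ≤ C * ‖z‖ ^ m := by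
  cases k with
  | zero =>
    simp only [fderiv_of_mem_zero hp]
    exact ⟨by simpa using continuous_const, 0, 0, by simp⟩
  | succ k =>
    have h := fderiv_apply_mem hp v
    obtain ⟨C, hC⟩ := exists_norm_le_of_mem h
    exact ⟨h.1.continuous, C, k, hC⟩

theorem integrable_mul_conj_gaussian [NeZero n] {u w : Cn n → ℂ} (hu : Continuous u)
    (hw : Continuous w) (hub : ∃ C m, ∀ z, ‖u z‖ ≤ C * ‖z‖ ^ m)
    (hwb : ∃ C m, ∀ z, ‖w z‖ ≤ C * ‖z‖ ^ m) :
    Integrable fun z => u z * conj (w z) * (Real.exp (-‖z‖ ^ 2) : ℂ) := by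
  obtain ⟨C, m, hC⟩ := hub
  obtain ⟨D, l, hD⟩ := hwb
  refine integrable_mul_gaussian (C := C * D) (m := m + l) (by fun_prop) fun z => ?_
  rw [norm_mul, RCLike.norm_conj]
  calc ‖u z‖ * ‖w z‖ ≤ (C * ‖z‖ ^ m) * (D * ‖z‖ ^ l) :=
        mul_le_mul (hC z) (hD z) (norm_nonneg _) ((norm_nonneg _).trans (hC z))
    _ = C * D * ‖z‖ ^ (m + l) := by ring

theorem exists_norm_mul_inner_le {k : ℕ} {p : Cn n → ℂ}
    (hp : p ∈ homogeneousHolomorphic n k) (v : Cn n) :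
    ∃ C m, ∀ z, ‖p z * (inner ℝ z v : ℂ)‖ ≤ C * ‖z‖ ^ m := by
  obtain ⟨C, hC⟩ := exists_norm_le_of_mem hp
  refine ⟨C * ‖v‖, k + 1, fun z => ?_⟩
  rw [norm_mul, Complex.norm_real]
  calc ‖p z‖ * ‖inner ℝ z v‖ ≤ (C * ‖z‖ ^ k) * (‖z‖ * ‖v‖) :=
        mul_le_mul (hC z) (norm_inner_le_norm z v) (norm_nonneg _) ((norm_nonneg _).trans (hC z))
    _ = C * ‖v‖ * ‖z‖ ^ (k + 1) := by ring

/-- Integration by parts against the Gaussian weight in a real direction. -/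
theorem integral_fderiv_mul_conj_gaussian [NeZero n] {a b : ℕ} {p q : Cn n → ℂ}
    (hp : p ∈ homogeneousHolomorphic n a) (hq : q ∈ homogeneousHolomorphic n b) (v : Cn n) :
    ∫ z, fderiv ℂ p z v * conj (q z) * (Real.exp (-‖z‖ ^ 2) : ℂ) =
      2 * (∫ z, p z * (inner ℝ z v : ℂ) * conj (q z) * (Real.exp (-‖z‖ ^ 2) : ℂ)) -
      ∫ z, p z * conj (fderiv ℂ q z v) * (Real.exp (-‖z‖ ^ 2) : ℂ) := by
  obtain ⟨Cp, hCp⟩ := exists_norm_le_of_mem hp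
  obtain ⟨Cq, hCq⟩ := exists_norm_le_of_mem hq
  obtain ⟨hcp', hbp'⟩ := exists_norm_fderiv_apply_le hp v
  obtain ⟨hcq', hbq'⟩ := exists_norm_fderiv_apply_le hq v
  have hcp := hp.1.continuous
  have hcq := hq.1.continuous
  have i1 := integrable_mul_conj_gaussian hcp' hcq hbp' ⟨_, _, hCq⟩
  have i2 := integrable_mul_conj_gaussian (u := fun z => p z * (inner ℝ z v : ℂ)) (by fun_prop) hcq
    (exists_norm_mul_inner_le hp v) ⟨_, _, hCq⟩
  have i3 := integrable_mul_conj_gaussian hcp hcq' ⟨_, _, hCp⟩ hbq'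
  have i4 := integrable_mul_conj_gaussian hcp hcq ⟨_, _, hCp⟩ ⟨_, _, hCq⟩
  have hval : ∀ z, p z * fderivConjMulGaussian q z v =
      p z * conj (fderiv ℂ q z v) * (Real.exp (-‖z‖ ^ 2) : ℂ) -
      2 * (p z * (inner ℝ z v : ℂ) * conj (q z) * (Real.exp (-‖z‖ ^ 2) : ℂ)) := by
    intro z
    simp [fderivConjMulGaussian]
    ring
  have key := integral_bilinear_hasFDerivAt_right_eq_neg_left_of_integrable
    (μ := (volume : Measure (Cn n))) (B := ContinuousLinearMap.mul ℝ ℂ) (v := v)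
    (f := p) (f' := fun z => (fderiv ℂ p z).restrictScalars ℝ)
    (g := fun z => conj (q z) * (Real.exp (-‖z‖ ^ 2) : ℂ)) (g' := fderivConjMulGaussian q)
    (by simpa [mul_assoc] using i1)
    (by
      simp only [ContinuousLinearMap.mul_apply', hval]
      exact i3.sub (i2.const_mul 2))
    (by simpa [mul_assoc] using i4)
    (fun z _ => (hp.1 z).hasFDerivAt.restrictScalars ℝ)
    (fun z _ => hasFDerivAt_conj_mul_gaussian hq.1 z)
  simp only [ContinuousLinearMap.mul_apply', hval, ContinuousLinearMap.coe_restrictScalars',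
    ← mul_assoc] at key
  rw [integral_sub i3 (by simpa only [mul_assoc] using i2.const_mul 2)] at key
  rw [eq_neg_iff_add_eq_zero] at key
  have h2 : ∫ z, 2 * p z * (inner ℝ z v : ℂ) * conj (q z) * (Real.exp (-‖z‖ ^ 2) : ℂ) =
      2 * ∫ z, p z * (inner ℝ z v : ℂ) * conj (q z) * (Real.exp (-‖z‖ ^ 2) : ℂ) := by
    rw [← integral_const_mul]
    simp only [mul_assoc]
  rw [h2] at key
  linear_combination key

theorem inner_single_one (z : Cn n) (i : Fin n) :
    inner ℝ z (EuclideanSpace.single i (1 : ℂ)) = (z i).re := by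
  rw [PiLp.inner_apply, Finset.sum_eq_single i]
  · simp [Complex.inner]
  · intro j _ hj; simp [hj]
  · simp

theorem inner_single_I (z : Cn n) (i : Fin n) :
    inner ℝ z (Complex.I • EuclideanSpace.single i (1 : ℂ)) = (z i).im := by
  rw [PiLp.inner_apply, Finset.sum_eq_single i]
  · simp [Complex.inner]
  · intro j _ hj; simp [hj]
  · simp

/-- In the Fock space the adjoint of `∂/∂zᵢ` is multiplication by `zᵢ`. -/
theorem integral_complexPartial_mul_conj_gaussian [NeZero n] {a b : ℕ} {p q : Cn n → ℂ}
    (hp : p ∈ homogeneousHolomorphic n a) (hq : q ∈ homogeneousHolomorphic n b) (i : Fin n) :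
    ∫ z, complexPartial i p z * conj (q z) * (Real.exp (-‖z‖ ^ 2) : ℂ) =
      ∫ z, p z * conj (z i * q z) * (Real.exp (-‖z‖ ^ 2) : ℂ) := by
  -- Real integrations by parts along `eᵢ` and `I • eᵢ` are combined as `h1 - I * h2`. The
  -- derivatives of `p` add up, those of `conj q` cancel by antiholomorphy, and the two real
  -- coordinates assemble into `conj zᵢ`.
  have h1 := integral_fderiv_mul_conj_gaussian hp hq (EuclideanSpace.single i (1 : ℂ))
  have h2 := integral_fderiv_mul_conj_gaussian hp hq (Complex.I • EuclideanSpace.single i (1 : ℂ))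
  obtain ⟨Cq, hCq⟩ := exists_norm_le_of_mem hq
  have hcp := hp.1.continuous
  have hcq := hq.1.continuous
  have i1 := integrable_mul_conj_gaussian
    (u := fun z => p z * (inner ℝ z (EuclideanSpace.single i (1 : ℂ)) : ℂ)) (by fun_prop) hcq
    (exists_norm_mul_inner_le hp _) ⟨_, _, hCq⟩
  have i2 := integrable_mul_conj_gaussian
    (u := fun z => p z * (inner ℝ z (Complex.I • EuclideanSpace.single i (1 : ℂ)) : ℂ))
    (by fun_prop) hcq (exists_norm_mul_inner_le hp _) ⟨_, _, hCq⟩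
  simp only [inner_single_one, inner_single_I] at h1 h2 i1 i2
  have h3 : ∀ z, fderiv ℂ p z (Complex.I • EuclideanSpace.single i (1 : ℂ)) * conj (q z) *
      (Real.exp (-‖z‖ ^ 2) : ℂ) =
      Complex.I * (complexPartial i p z * conj (q z) * (Real.exp (-‖z‖ ^ 2) : ℂ)) := fun z => by
    rw [map_smul, complexPartial, smul_eq_mul]; ring
  have h4 : ∀ z, p z * conj (fderiv ℂ q z (Complex.I • EuclideanSpace.single i (1 : ℂ))) *
      (Real.exp (-‖z‖ ^ 2) : ℂ) = -Complex.I * (p z *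
        conj (fderiv ℂ q z (EuclideanSpace.single i (1 : ℂ))) * (Real.exp (-‖z‖ ^ 2) : ℂ)) :=
    fun z => by
      rw [map_smul, smul_eq_mul, map_mul, Complex.conj_I]; ring
  simp only [h3, h4, integral_const_mul] at h2
  have h5 : ∀ z : Cn n, p z * conj (z i * q z) * (Real.exp (-‖z‖ ^ 2) : ℂ) =
      p z * ((z i).re : ℂ) * conj (q z) * (Real.exp (-‖z‖ ^ 2) : ℂ) -
      Complex.I * (p z * ((z i).im : ℂ) * conj (q z) * (Real.exp (-‖z‖ ^ 2) : ℂ)) := fun z => by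
    have h6 : conj (z i) = ((z i).re : ℂ) - Complex.I * ((z i).im : ℂ) := by
      apply Complex.ext <;> simp
    rw [map_mul, h6]; ring
  simp only [h5]
  rw [integral_sub i1 (i2.const_mul _), integral_const_mul]
  have h1' : ∫ z, complexPartial i p z * conj (q z) * (Real.exp (-‖z‖ ^ 2) : ℂ) = _ := h1
  linear_combination (h1' - Complex.I * h2) / 2 +
    (∫ z, complexPartial i p z * conj (q z) * (Real.exp (-‖z‖ ^ 2) : ℂ)) / 2 * Complex.I_mul_I -
    (∫ z, p z * conj (fderiv ℂ q z (EuclideanSpace.single i (1 : ℂ))) *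
      (Real.exp (-‖z‖ ^ 2) : ℂ)) / 2 * Complex.I_mul_I

/-- Apply the adjoint relation with `q = ∂ᵢp`; summing over `i` turns `∑ zᵢ ∂ᵢp` into `(k+1) p` by
Euler's identity. -/
theorem sum_integral_complexPartial_gaussian [NeZero n] {k : ℕ} {p : Cn n → ℂ}
    (hp : p ∈ homogeneousHolomorphic n (k + 1)) :
    ∑ i, ∫ z, ‖complexPartial i p z‖ ^ 2 * Real.exp (-‖z‖ ^ 2) =
      (k + 1) * ∫ z, ‖p z‖ ^ 2 * Real.exp (-‖z‖ ^ 2) := by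
  have hc : ∀ (u : ℂ) (t : ℝ), ((‖u‖ ^ 2 * t : ℝ) : ℂ) = u * conj u * (t : ℂ) := fun u t => by
    rw [Complex.mul_conj, Complex.normSq_eq_norm_sq]; push_cast; ring
  apply Complex.ofReal_injective
  rw [Complex.ofReal_mul, ← integral_complex_ofReal, Complex.ofReal_sum]
  simp only [← integral_complex_ofReal, hc]
  have h1 : ∀ i : Fin n, ∫ z, complexPartial i p z * conj (complexPartial i p z) *
      (Real.exp (-‖z‖ ^ 2) : ℂ) =
      ∫ z, p z * conj (z i * complexPartial i p z) * (Real.exp (-‖z‖ ^ 2) : ℂ) := fun i =>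
    integral_complexPartial_mul_conj_gaussian hp (complexPartial_mem hp i) i
  rw [Finset.sum_congr rfl fun i _ => h1 i, ← integral_finsetSum, ← integral_const_mul]
  · refine integral_congr_ae (ae_of_all _ fun z => ?_)
    beta_reduce
    rw [← Finset.sum_mul, ← Finset.mul_sum, ← map_sum, sum_coord_mul_complexPartial hp, map_mul,
      map_natCast]
    push_cast
    ring
  · intro i _
    obtain ⟨C, hC⟩ := exists_norm_le_of_mem hp
    obtain ⟨D, hD⟩ := exists_norm_le_of_mem (complexPartial_mem hp i)
    have hcp := hp.1.continuous
    have hcq := (complexPartial_mem hp i).1.continuous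
    refine integrable_mul_conj_gaussian hcp (w := fun z => z i * complexPartial i p z)
      (by fun_prop) ⟨_, _, hC⟩ ⟨D, k + 1, fun z => ?_⟩
    rw [norm_mul, pow_succ, mul_comm (‖z‖ ^ k), mul_left_comm]
    exact mul_le_mul (PiLp.norm_apply_le z i) (hD z) (norm_nonneg _) (norm_nonneg _)

/-- Homogeneity contributes `t^{2k}` to the polar Jacobian `t^{2n-1}`, so the radial and spherical
integrals separate. -/
theorem lintegral_homogeneous_mul_radial [NeZero n] {k : ℕ} {p : Cn n → ℂ}
    (hp : p ∈ homogeneousHolomorphic n k) {w : ℝ → ℝ≥0∞} (hw : Measurable w) :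
    ∫⁻ z, ‖p z‖ₑ ^ 2 * w ‖z‖ = (volume : Measure (Cn n)).toSphere Set.univ *
      (∫⁻ t in Set.Ioi (0 : ℝ), ENNReal.ofReal (t ^ (2 * (n + k) - 1)) * w t) *
        sphereSqNorm p := by
  have hcp := hp.1.continuous
  rw [lintegral_polar (by fun_prop), mul_assoc]
  congr 1
  rw [← lintegral_mul_const _ (by fun_prop)]
  refine setLIntegral_congr_fun measurableSet_Ioi fun t (ht : 0 < t) => ?_
  have h1 : ∀ ζ : sphere (0 : Cn n) 1, ‖p (t • (ζ : Cn n))‖ₑ ^ 2 * w ‖t • (ζ : Cn n)‖ =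
      (ENNReal.ofReal (t ^ (2 * k)) * w t) * ‖p ζ‖ₑ ^ 2 := by
    intro ζ
    have h4 : t • (ζ : Cn n) = (t : ℂ) • (ζ : Cn n) := (Complex.coe_smul t _).symm
    rw [norm_smul, norm_eq_of_mem_sphere, mul_one, Real.norm_of_nonneg ht.le, h4, hp.2, enorm_mul,
      mul_pow, enorm_pow, ← pow_mul, mul_comm k 2, ENNReal.ofReal_pow ht.le, ← ofReal_norm,
      Complex.norm_real, Real.norm_of_nonneg ht.le]
    ring
  have hn : 2 * (n + k) - 1 = (2 * n - 1) + 2 * k := by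
    have := Nat.pos_of_ne_zero (NeZero.ne n)
    omega
  simp only [h1]
  have hm : Measurable fun ζ : sphere (0 : Cn n) 1 => ‖p ζ‖ₑ ^ 2 :=
    (hcp.measurable.comp measurable_subtype_coe).enorm.pow_const 2
  rw [lintegral_const_mul _ hm, hn, pow_add, ENNReal.ofReal_mul (by positivity),
    sphereSqNorm]
  ring

theorem lintegral_pow_mul_gaussian {m : ℕ} (hm : 1 ≤ m) :
    ∫⁻ t in Set.Ioi (0 : ℝ), ENNReal.ofReal (t ^ (2 * m - 1)) * ENNReal.ofReal (Real.exp (-t ^ 2)) =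
      ENNReal.ofReal ((m - 1).factorial / 2) := by
  have h1 := integral_rpow_mul_exp_neg_rpow (p := 2) (q := ((2 * m - 1 : ℕ) : ℝ)) (by norm_num)
    (by have : (0 : ℝ) ≤ ((2 * m - 1 : ℕ) : ℝ) := Nat.cast_nonneg _
        linarith)
  have h2 : (((2 * m - 1 : ℕ) : ℝ) + 1) / 2 = ((m - 1 : ℕ) : ℝ) + 1 := by
    rw [Nat.cast_sub (by omega), Nat.cast_sub hm]; push_cast; ring
  rw [h2, Real.Gamma_nat_eq_factorial] at h1
  simp only [Real.rpow_natCast, Real.rpow_ofNat] at h1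
  have h3 : IntegrableOn (fun t : ℝ => t ^ (2 * m - 1) * Real.exp (-t ^ 2)) (Set.Ioi 0) := by
    refine Integrable.of_integral_ne_zero ?_
    rw [h1]; positivity
  have h4 := ofReal_integral_eq_lintegral_ofReal h3 (by
    filter_upwards [ae_restrict_mem measurableSet_Ioi] with t ht
    have : 0 < t := ht
    positivity)
  rw [h1] at h4
  rw [div_eq_inv_mul, ← one_div, h4]
  refine setLIntegral_congr_fun measurableSet_Ioi fun t (ht : 0 < t) => ?_
  rw [ENNReal.ofReal_mul (by positivity)]

theorem ofReal_integral_sq_gaussian [NeZero n] {k : ℕ} {p : Cn n → ℂ}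
    (hp : p ∈ homogeneousHolomorphic n k) :
    ENNReal.ofReal (∫ z, ‖p z‖ ^ 2 * Real.exp (-‖z‖ ^ 2)) =
      (volume : Measure (Cn n)).toSphere Set.univ *
        ENNReal.ofReal ((n + k - 1).factorial / 2) * sphereSqNorm p := by
  have hn := Nat.pos_of_ne_zero (NeZero.ne n)
  obtain ⟨C, hC⟩ := exists_norm_le_of_mem hp
  have hcp := hp.1.continuous
  have hi : Integrable fun z => ‖p z‖ ^ 2 * Real.exp (-‖z‖ ^ 2) := by
    refine (integrable_mul_conj_gaussian hcp hcp ⟨_, _, hC⟩ ⟨_, _, hC⟩).norm.congr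
      (ae_of_all _ fun z => ?_)
    beta_reduce
    rw [norm_mul, norm_mul, RCLike.norm_conj, Complex.norm_real,
      Real.norm_of_nonneg (Real.exp_pos _).le]
    ring
  rw [ofReal_integral_eq_lintegral_ofReal hi (ae_of_all _ fun z => by positivity),
    ← lintegral_pow_mul_gaussian (by omega),
    ← lintegral_homogeneous_mul_radial hp (w := fun t => ENNReal.ofReal (Real.exp (-t ^ 2)))
      (by fun_prop)]
  refine lintegral_congr fun z => ?_
  rw [ENNReal.ofReal_mul (by positivity), ENNReal.ofReal_pow (norm_nonneg _), ofReal_norm]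

/-- The gradient of a homogeneous holomorphic function in mean square over the sphere. -/
theorem sum_sphereSqNorm_complexPartial [NeZero n] {k : ℕ} {p : Cn n → ℂ}
    (hp : p ∈ homogeneousHolomorphic n (k + 1)) :
    ∑ i, sphereSqNorm (complexPartial i p) = ((k + 1) * (n + k) : ℕ) * sphereSqNorm p := by
  have hn := Nat.pos_of_ne_zero (NeZero.ne n)
  have h := congrArg ENNReal.ofReal (sum_integral_complexPartial_gaussian hp)
  rw [ENNReal.ofReal_sum_of_nonneg fun i _ => integral_nonneg fun z => by positivity,
    ENNReal.ofReal_mul (by positivity), ofReal_integral_sq_gaussian hp,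
    Finset.sum_congr rfl fun i _ => ofReal_integral_sq_gaussian (complexPartial_mem hp i),
    ← Finset.mul_sum] at h
  set c : ℝ≥0∞ := (volume : Measure (Cn n)).toSphere Set.univ *
    ENNReal.ofReal ((n + k - 1).factorial / 2) with hc
  have hc0 : c ≠ 0 := by
    refine mul_ne_zero toSphere_univ_ne_zero ?_
    rw [ne_eq, ENNReal.ofReal_eq_zero, not_le]
    positivity
  have hct : c ≠ ∞ := ENNReal.mul_ne_top (measure_ne_top _ _) ENNReal.ofReal_ne_top
  -- Degrees `k+1` and `k` have radial Gaussian integrals `(n+k)!/2` and `(n+k-1)!/2`; their ratio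
  -- supplies the factor `n + k`, while Euler's identity supplied `k + 1`.
  have hf : ENNReal.ofReal ((n + (k + 1) - 1).factorial / 2) =
      (n + k : ℕ) * ENNReal.ofReal ((n + k - 1).factorial / 2) := by
    have h1 : n + (k + 1) - 1 = (n + k - 1) + 1 := by omega
    have h2 : n + k - 1 + 1 = n + k := by omega
    rw [h1, Nat.factorial_succ, h2, ← ENNReal.ofReal_natCast (n + k),
      ← ENNReal.ofReal_mul (by positivity)]
    push_cast
    ring_nf
  have hk : ENNReal.ofReal ((k : ℝ) + 1) = ((k + 1 : ℕ) : ℝ≥0∞) := by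
    rw [← ENNReal.ofReal_natCast (k + 1)]; push_cast; rfl
  rw [hf, hk] at h
  rw [← ENNReal.mul_right_inj hc0 hct, h, hc]
  push_cast
  ring

end Fock

/-! ### Commuting partial derivatives and sums over multi-indices. -/

section MultiIndex

variable {n : ℕ}

/-- Directional derivatives are again holomorphic, so smoothness follows by induction; order two
gives the symmetry of mixed partials. -/
theorem contDiff_of_differentiable (m : ℕ) : ∀ {p : Cn n → ℂ}, Differentiable ℂ p →
    ContDiff ℂ m p := by
  induction m with
  | zero => exact fun hp => contDiff_zero.mpr hp.continuous
  | succ m ih =>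
    intro p hp
    rw [Nat.cast_succ, contDiff_succ_iff_fderiv_apply]
    exact ⟨hp, fun h => by simp at h, fun v => ih (differentiableOn_univ.mp
      (differentiableOn_fderiv_apply isOpen_univ hp.differentiableOn v))⟩

theorem differentiable_complexPartial {p : Cn n → ℂ} (hp : Differentiable ℂ p) (i : Fin n) :
    Differentiable ℂ (complexPartial i p) :=
  differentiableOn_univ.mp (differentiableOn_complexPartial isOpen_univ hp.differentiableOn i)

theorem complexPartial_comm {p : Cn n → ℂ} (hp : Differentiable ℂ p) (i j : Fin n) :
    complexPartial i (complexPartial j p) = complexPartial j (complexPartial i p) := by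
  have hd : Differentiable ℂ (fderiv ℂ p) :=
    ((contDiff_of_differentiable 2 hp).fderiv_right (m := 1) (by norm_num)).differentiable
      (by norm_num)
  funext z
  have h : ∀ i j : Fin n, complexPartial i (complexPartial j p) z =
      fderiv ℂ (fderiv ℂ p) z (EuclideanSpace.single i 1) (EuclideanSpace.single j 1) := by
    intro i j
    have h1 := (hd z).hasFDerivAt.clm_apply
      (hasFDerivAt_const (EuclideanSpace.single j (1 : ℂ)) z)
    change fderiv ℂ (fun w => fderiv ℂ p w (EuclideanSpace.single j 1)) z _ = _
    rw [h1.fderiv]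
    simp
  rw [h, h]
  exact second_derivative_symmetric (fun y => (hp y).hasFDerivAt) (hd z).hasFDerivAt _ _

theorem differentiable_iterate_complexPartial {p : Cn n → ℂ} (hp : Differentiable ℂ p)
    (i : Fin n) (m : ℕ) : Differentiable ℂ ((complexPartial i)^[m] p) := by
  induction m with
  | zero => exact hp
  | succ m ih => rw [Function.iterate_succ_apply']; exact differentiable_complexPartial ih i

theorem iterate_complexPartial_comm {p : Cn n → ℂ} (hp : Differentiable ℂ p) (i j : Fin n)
    (m : ℕ) : (complexPartial i)^[m] (complexPartial j p) =
      complexPartial j ((complexPartial i)^[m] p) := by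
  induction m with
  | zero => rfl
  | succ m ih =>
    rw [Function.iterate_succ_apply', Function.iterate_succ_apply', ih,
      complexPartial_comm (differentiable_iterate_complexPartial hp i m)]

/-- The iterated partial derivative over the coordinates in a list. -/
def complexPartialList (l : List (Fin n)) (α : Fin n → ℕ) (g : Cn n → ℂ) : Cn n → ℂ :=
  l.foldr (fun i h => (complexPartial i)^[α i] h) g

theorem differentiable_complexPartialList {p : Cn n → ℂ} (hp : Differentiable ℂ p)
    (l : List (Fin n)) (α : Fin n → ℕ) : Differentiable ℂ (complexPartialList l α p) := by
  induction l with
  | nil => exact hp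
  | cons i l ih => exact differentiable_iterate_complexPartial ih i (α i)

theorem complexPartialList_complexPartial {p : Cn n → ℂ} (hp : Differentiable ℂ p)
    (l : List (Fin n)) (α : Fin n → ℕ) (j : Fin n) :
    complexPartialList l α (complexPartial j p) = complexPartial j (complexPartialList l α p) := by
  induction l with
  | nil => rfl
  | cons i l ih =>
    change (complexPartial i)^[α i] (complexPartialList l α (complexPartial j p)) =
      complexPartial j ((complexPartial i)^[α i] (complexPartialList l α p))
    rw [ih, iterate_complexPartial_comm (differentiable_complexPartialList hp l α)]

theorem complexPartialList_add_single_of_notMem (l : List (Fin n)) (α : Fin n → ℕ) {j : Fin n}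
    (hj : j ∉ l) (p : Cn n → ℂ) :
    complexPartialList l (α + Pi.single j 1) p = complexPartialList l α p := by
  induction l with
  | nil => rfl
  | cons i l ih =>
    have hij : i ≠ j := fun h => hj (by simp [h])
    change (complexPartial i)^[(α + Pi.single j 1 : Fin n → ℕ) i]
      (complexPartialList l (α + Pi.single j 1) p) =
      (complexPartial i)^[α i] (complexPartialList l α p)
    rw [ih fun h => hj (List.mem_cons_of_mem _ h)]
    simp [hij]

theorem complexPartialList_add_single {p : Cn n → ℂ} (hp : Differentiable ℂ p)
    {l : List (Fin n)} (hl : l.Nodup) (α : Fin n → ℕ) {j : Fin n} (hj : j ∈ l) :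
    complexPartialList l (α + Pi.single j 1) p = complexPartial j (complexPartialList l α p) := by
  induction l with
  | nil => simp at hj
  | cons i l ih =>
    change (complexPartial i)^[(α + Pi.single j 1 : Fin n → ℕ) i]
      (complexPartialList l (α + Pi.single j 1) p) =
      complexPartial j ((complexPartial i)^[α i] (complexPartialList l α p))
    rw [List.nodup_cons] at hl
    by_cases hij : i = j
    · subst hij
      rw [complexPartialList_add_single_of_notMem l α hl.1]
      simp only [Pi.add_apply, Pi.single_eq_same]
      rw [Function.iterate_succ_apply']
    · have hjl : j ∈ l := (List.mem_cons.mp hj).resolve_left fun h => hij h.symm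
      rw [ih hl.2 hjl, Pi.add_apply, Pi.single_eq_of_ne hij, add_zero,
        iterate_complexPartial_comm (differentiable_complexPartialList hp l α)]

theorem complexPartialMulti_add_single {p : Cn n → ℂ} (hp : Differentiable ℂ p)
    (α : Fin n → ℕ) (j : Fin n) :
    complexPartialMulti (α + Pi.single j 1) p = complexPartialMulti α (complexPartial j p) :=
  (complexPartialList_add_single hp (List.nodup_finRange n) α (List.mem_finRange j)).trans
    (complexPartialList_complexPartial hp _ α j).symm

theorem complexPartialMulti_zero (p : Cn n → ℂ) : complexPartialMulti 0 p = p := by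
  change complexPartialList _ 0 p = p
  generalize List.finRange n = l
  induction l with
  | nil => rfl
  | cons i l ih => exact ih

theorem taylorPart_complexPartialMulti {f : Cn n → ℂ} (hf : DifferentiableOn ℂ f (unitBall n))
    (α : Fin n → ℕ) :
    DifferentiableOn ℂ (complexPartialMulti α f) (unitBall n) ∧
    ∀ k, taylorPart k (complexPartialMulti α f) =
      complexPartialMulti α (taylorPart (k + ∑ i, α i) f) := by
  have hiter : ∀ (i : Fin n) (m : ℕ) {g : Cn n → ℂ}, DifferentiableOn ℂ g (unitBall n) →
      DifferentiableOn ℂ ((complexPartial i)^[m] g) (unitBall n) ∧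
      ∀ k, taylorPart k ((complexPartial i)^[m] g) =
        (complexPartial i)^[m] (taylorPart (k + m) g) := by
    intro i m g hg
    induction m with
    | zero => exact ⟨hg, fun k => rfl⟩
    | succ m ih =>
      simp only [Function.iterate_succ_apply']
      refine ⟨differentiableOn_complexPartial isOpen_ball ih.1 i, fun k => ?_⟩
      rw [taylorPart_complexPartial ih.1, ih.2]
      congr 3
      ring
  rw [Fin.sum_univ_def]
  change DifferentiableOn ℂ (complexPartialList _ α f) (unitBall n) ∧
    ∀ k, taylorPart k (complexPartialList _ α f) = complexPartialList _ α _
  generalize List.finRange n = l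
  induction l with
  | nil => exact ⟨hf, fun k => rfl⟩
  | cons i l ih =>
    obtain ⟨h1, h2⟩ := hiter i (α i) ih.1
    refine ⟨h1, fun k => ?_⟩
    refine (h2 k).trans ?_
    rw [ih.2]
    change _ = (complexPartial i)^[α i] (complexPartialList l α _)
    congr 3
    rw [List.map_cons, List.sum_cons]
    ring

/-- A multi-index `γ` of order `J + 1` equals `α + eᵢ` once for each `i` with `γ i ≠ 0`, hence at
least once and at most `n` times. This crude count replaces multinomial weights. -/
theorem sum_sum_add_single (J : ℕ) (g : (Fin n → ℕ) → ℝ≥0∞) :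
    ∑ γ ∈ Finset.piAntidiag (Finset.univ : Finset (Fin n)) (J + 1), g γ ≤
      ∑ i, ∑ α ∈ Finset.piAntidiag (Finset.univ : Finset (Fin n)) J, g (α + Pi.single i 1) ∧
    ∑ i, ∑ α ∈ Finset.piAntidiag (Finset.univ : Finset (Fin n)) J, g (α + Pi.single i 1) ≤
      n * ∑ γ ∈ Finset.piAntidiag (Finset.univ : Finset (Fin n)) (J + 1), g γ := by
  have h1 : ∀ i : Fin n,
      ∑ α ∈ Finset.piAntidiag (Finset.univ : Finset (Fin n)) J, g (α + Pi.single i 1) =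
      ∑ γ ∈ Finset.piAntidiag (Finset.univ : Finset (Fin n)) (J + 1),
        if γ i ≠ 0 then g γ else 0 := by
    intro i
    rw [← Finset.sum_filter]
    refine Finset.sum_nbij' (fun α => α + Pi.single i 1) (fun γ => γ - Pi.single i 1) ?_ ?_ ?_ ?_ ?_
    · intro α hα
      rw [Finset.mem_piAntidiag] at hα
      simp [Finset.mem_piAntidiag, Finset.sum_add_distrib, hα.1]
    · intro γ hγ
      rw [Finset.mem_filter, Finset.mem_piAntidiag] at hγ
      have h2 : γ = (γ - Pi.single i 1) + Pi.single i 1 := by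
        funext j
        by_cases hj : j = i
        · subst hj
          have := hγ.2
          simp only [Pi.add_apply, Pi.sub_apply, Pi.single_eq_same]; omega
        · simp [hj]
      have h3 := hγ.1.1
      rw [h2] at h3
      simp only [Pi.add_apply, Finset.sum_add_distrib] at h3
      simp only [Finset.sum_pi_single', Finset.mem_univ, if_true] at h3
      simp only [Finset.mem_piAntidiag, Finset.mem_univ, implies_true, and_true]
      change ∑ x, (γ - Pi.single i 1 : Fin n → ℕ) x = J
      omega
    · intro α _; simp
    · intro γ hγ
      rw [Finset.mem_filter] at hγ
      funext j
      by_cases hj : j = i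
      · subst hj
        have := hγ.2
        simp only [Pi.add_apply, Pi.sub_apply, Pi.single_eq_same]; omega
      · simp [hj]
    · intro α _; rfl
  simp only [h1]
  rw [Finset.sum_comm, Finset.mul_sum]
  constructor
  · refine Finset.sum_le_sum fun γ hγ => ?_
    rw [Finset.mem_piAntidiag] at hγ
    obtain ⟨i, -, hi⟩ : ∃ i ∈ Finset.univ, γ i ≠ 0 :=
      Finset.exists_ne_zero_of_sum_ne_zero (by rw [hγ.1]; omega)
    calc g γ = if γ i ≠ 0 then g γ else 0 := by rw [if_pos hi]
      _ ≤ _ := Finset.single_le_sum (f := fun i => if γ i ≠ 0 then g γ else 0)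
        (fun _ _ => zero_le) (Finset.mem_univ i)
  · refine Finset.sum_le_sum fun γ _ => ?_
    calc ∑ i, (if γ i ≠ 0 then g γ else 0) ≤ ∑ _i : Fin n, g γ :=
          Finset.sum_le_sum fun i _ => by split_ifs <;> simp
      _ = n * g γ := by simp

/-- The constant relating a homogeneous function of degree `k + J` to its derivatives of
order `J`. -/
def gradientFactor (n k J : ℕ) : ℕ := ∏ j ∈ Finset.range J, (k + j + 1) * (n + k + j)

/-- The sum of the mean squares of the partial derivatives of order `J` over the sphere. -/
def derivSqNorm (J : ℕ) (p : Cn n → ℂ) : ℝ≥0∞ :=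
  ∑ α ∈ Finset.piAntidiag (Finset.univ : Finset (Fin n)) J, sphereSqNorm (complexPartialMulti α p)

theorem derivSqNorm_succ {J : ℕ} {p : Cn n → ℂ} (hp : Differentiable ℂ p) :
    derivSqNorm (J + 1) p ≤ ∑ i, derivSqNorm J (complexPartial i p) ∧
    ∑ i, derivSqNorm J (complexPartial i p) ≤ n * derivSqNorm (J + 1) p := by
  have h := sum_sum_add_single J fun γ : Fin n → ℕ => sphereSqNorm (complexPartialMulti γ p)
  simp only [complexPartialMulti_add_single hp] at h
  exact h

/-- Induction on `J`, applying the gradient identity once per order of derivative; each passage from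
directions to multi-indices costs at most a factor `n`. -/
theorem derivSqNorm_bounds [NeZero n] {k : ℕ} (J : ℕ) : ∀ {p : Cn n → ℂ},
    p ∈ homogeneousHolomorphic n (k + J) →
    derivSqNorm J p ≤ gradientFactor n k J * sphereSqNorm p ∧
    gradientFactor n k J * sphereSqNorm p ≤ (n : ℝ≥0∞) ^ J * derivSqNorm J p := by
  induction J with
  | zero =>
    intro p _
    simp [derivSqNorm, gradientFactor, complexPartialMulti_zero]
  | succ J ih =>
    intro p hp
    obtain ⟨h1, h2⟩ := derivSqNorm_succ (J := J) hp.1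
    have h3 : ∑ i, (gradientFactor n k J : ℝ≥0∞) * sphereSqNorm (complexPartial i p) =
        gradientFactor n k (J + 1) * sphereSqNorm p := by
      rw [← Finset.mul_sum, sum_sphereSqNorm_complexPartial (k := k + J) hp, ← mul_assoc,
        ← Nat.cast_mul, gradientFactor, gradientFactor, Finset.prod_range_succ, add_assoc n]
    have hm := fun i => ih (complexPartial_mem (k := k + J) hp i)
    rw [← h3]
    refine ⟨h1.trans (Finset.sum_le_sum fun i _ => (hm i).1), ?_⟩
    calc _ ≤ ∑ i, (n : ℝ≥0∞) ^ J * derivSqNorm J (complexPartial i p) :=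
          Finset.sum_le_sum fun i _ => (hm i).2
      _ ≤ (n : ℝ≥0∞) ^ J * (n * derivSqNorm (J + 1) p) := by
          rw [← Finset.mul_sum]; gcongr
      _ = _ := by rw [pow_succ, mul_assoc]

end MultiIndex

/-! ### The weighted tail as a diagonal form, and estimates of its multipliers. -/

section TailWeight

variable {n : ℕ}

/-- Polar coordinates reduce the tail to spherical means of `g`, which Parseval expands degree by
degree, with powers `t^{2k}` joining the Jacobian. -/
theorem lintegral_tail_ballMeasure [NeZero n] {g : Cn n → ℂ}
    (hg : DifferentiableOn ℂ g (unitBall n)) {W : ℝ → ℝ≥0∞} (hW : Measurable W) {r : ℝ}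
    (hr : 0 < r) :
    ∫⁻ w in unitBall n \ ball (0 : Cn n) r, ‖g w‖ₑ ^ 2 * W ‖w‖ ∂(ballMeasure n) =
      ∑' k, (2 * n * ∫⁻ t in Set.Ico r 1, ENNReal.ofReal (t ^ (2 * (n + k) - 1)) * W t) *
        sphereSqNorm (taylorPart k g) := by
  classical
  have hn := Nat.pos_of_ne_zero (NeZero.ne n)
  set A : Set (Cn n) := unitBall n \ ball (0 : Cn n) r with hA
  have hAm : MeasurableSet A := measurableSet_ball.diff measurableSet_ball
  have hgm : Measurable ((unitBall n).indicator g) := by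
    rw [← Set.piecewise_eq_indicator]
    exact hg.continuousOn.measurable_piecewise continuousOn_const measurableSet_ball
  have hFm : Measurable (A.indicator fun w => ‖(unitBall n).indicator g w‖ₑ ^ 2 * W ‖w‖) :=
    Measurable.indicator (by fun_prop) hAm
  have hv0 : volume (unitBall n) ≠ 0 := (isOpen_ball.measure_pos _ ⟨0, by simp⟩).ne'
  have hvt : volume (unitBall n) ≠ ∞ := measure_ball_lt_top.ne
  -- The total surface measure is the real dimension `2n` times the volume of the ball, whence the
  -- constant `2n` in `tailWeight`.
  have hσ : (volume (unitBall n))⁻¹ * (volume : Measure (Cn n)).toSphere Set.univ = 2 * n := by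
    rw [Measure.toSphere_apply_univ, finrank_real_Cn, mul_comm, mul_assoc,
      ENNReal.mul_inv_cancel hv0 hvt]
    push_cast
    ring
  have h1 : ∫⁻ w in A, ‖g w‖ₑ ^ 2 * W ‖w‖ ∂(ballMeasure n) = (volume (unitBall n))⁻¹ *
      ∫⁻ w, A.indicator (fun w => ‖(unitBall n).indicator g w‖ₑ ^ 2 * W ‖w‖) w := by
    rw [ballMeasure, Measure.restrict_smul, lintegral_smul_measure, smul_eq_mul,
      Measure.restrict_restrict hAm, Set.inter_eq_left.mpr Set.sdiff_subset,
      lintegral_indicator hAm]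
    congr 1
    refine setLIntegral_congr_fun hAm fun w hw => ?_
    rw [Set.indicator_of_mem hw.1]
  have h2 : ∀ t ∈ Set.Ioi (0 : ℝ), ENNReal.ofReal (t ^ (2 * n - 1)) *
      ∫⁻ ζ : sphere (0 : Cn n) 1, A.indicator
        (fun w => ‖(unitBall n).indicator g w‖ₑ ^ 2 * W ‖w‖) (t • (ζ : Cn n)) ∂(sphereMeasure n) =
      (Set.Ico r 1).indicator (fun t => ∑' k, (ENNReal.ofReal (t ^ (2 * (n + k) - 1)) * W t) *
        sphereSqNorm (taylorPart k g)) t := by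
    intro t (ht : 0 < t)
    have hnorm : ∀ ζ : sphere (0 : Cn n) 1, ‖t • (ζ : Cn n)‖ = t := fun ζ => by
      rw [norm_smul, norm_eq_of_mem_sphere, mul_one, Real.norm_of_nonneg ht.le]
    by_cases htr : t ∈ Set.Ico r 1
    · have h3 : ∀ ζ : sphere (0 : Cn n) 1, A.indicator
          (fun w => ‖(unitBall n).indicator g w‖ₑ ^ 2 * W ‖w‖) (t • (ζ : Cn n)) =
          W t * ‖g (t • (ζ : Cn n))‖ₑ ^ 2 := fun ζ => by
        have hb : t • (ζ : Cn n) ∈ unitBall n := smul_mem_unitBall ⟨ht, htr.2⟩ ζ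
        have ha : t • (ζ : Cn n) ∈ A :=
          ⟨hb, by rw [mem_ball_zero_iff, hnorm]; exact not_lt.mpr htr.1⟩
        rw [Set.indicator_of_mem ha, Set.indicator_of_mem hb, hnorm, mul_comm]
      have hcont : Continuous fun ζ : sphere (0 : Cn n) 1 => g (t • (ζ : Cn n)) :=
        hg.continuousOn.comp_continuous (by fun_prop) fun ζ => smul_mem_unitBall ⟨ht, htr.2⟩ ζ
      simp only [h3]
      rw [lintegral_const_mul _ (hcont.measurable.enorm.pow_const 2),
        lintegral_sphere_dilate hg ⟨ht, htr.2⟩, Set.indicator_of_mem htr, ← mul_assoc,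
        ← ENNReal.tsum_mul_left]
      refine tsum_congr fun k => ?_
      have hk : 2 * (n + k) - 1 = (2 * n - 1) + 2 * k := by omega
      rw [hk, pow_add, ENNReal.ofReal_mul (by positivity)]
      ring
    · have h3 : ∀ ζ : sphere (0 : Cn n) 1, A.indicator
          (fun w => ‖(unitBall n).indicator g w‖ₑ ^ 2 * W ‖w‖) (t • (ζ : Cn n)) = 0 := fun ζ => by
        refine Set.indicator_of_notMem (fun hmem => htr ⟨?_, ?_⟩) _
        · have := hmem.2
          rw [mem_ball_zero_iff, hnorm] at this
          exact not_lt.mp this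
        · have := hmem.1
          rwa [mem_ball_zero_iff, hnorm] at this
      simp only [h3]
      rw [Set.indicator_of_notMem htr, lintegral_zero, mul_zero]
  have hsub : Set.Ico r 1 ⊆ Set.Ioi 0 := fun t ht => hr.trans_le ht.1
  rw [h1, lintegral_polar hFm, ← mul_assoc, hσ, setLIntegral_congr_fun measurableSet_Ioi h2,
    setLIntegral_indicator measurableSet_Ico,
    Set.inter_eq_left.mpr hsub, lintegral_tsum fun k => by fun_prop,
    ← ENNReal.tsum_mul_left]
  refine tsum_congr fun k => ?_
  rw [lintegral_mul_const _ (by fun_prop), mul_assoc, mul_assoc, mul_assoc]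

/-- The radial integral weighting the homogeneous part of degree `k` of the derivatives of
order `J`. -/
def tailWeight (n J k : ℕ) (r : ℝ) : ℝ≥0∞ :=
  2 * n * ∫⁻ t in Set.Ico r 1,
    ENNReal.ofReal (t ^ (2 * (n + k) - 1)) * ENNReal.ofReal ((1 - t ^ 2) ^ (2 * J - 1))

/-- A derivative of order `J` lowers the degree by `J`: its part of degree `k` comes from the part
of degree `k + J` of `f`. -/
theorem weightedTail_eq [NeZero n] (J : ℕ) {f : unitBall n → ℂ} (hf : IsHolomorphicOnBall f)
    {r : ℝ} (hr : 0 < r) :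
    weightedTail J r f =
      ∑' k, tailWeight n J k r * derivSqNorm J (taylorPart (k + J) (zeroExt f)) := by
  simp only [derivSqNorm, Finset.mul_sum]
  rw [Summable.tsum_finsetSum fun _ _ => ENNReal.summable, weightedTail]
  refine Finset.sum_congr rfl fun α hα => ?_
  obtain ⟨h1, h2⟩ := taylorPart_complexPartialMulti hf α
  rw [(Finset.mem_piAntidiag.mp hα).1] at h2
  simp only [← h2]
  exact lintegral_tail_ballMeasure h1
    (W := fun t => ENNReal.ofReal ((1 - t ^ 2) ^ (2 * J - 1))) (by fun_prop) hr

/-- The weighted tail of order `J`, up to constants. -/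
def hardyTail (J : ℕ) (r : ℝ) (f : Cn n → ℂ) : ℝ≥0∞ :=
  ∑' k, (gradientFactor n k J * tailWeight n J k r) * sphereSqNorm (taylorPart (k + J) f)

theorem weightedTail_le_hardyTail [NeZero n] (J : ℕ) {f : unitBall n → ℂ}
    (hf : IsHolomorphicOnBall f) {r : ℝ} (hr : 0 < r) :
    weightedTail J r f ≤ hardyTail J r (zeroExt f) := by
  rw [weightedTail_eq J hf hr]
  refine ENNReal.tsum_le_tsum fun k => ?_
  rw [mul_comm (gradientFactor n k J : ℝ≥0∞), mul_assoc]
  gcongr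
  exact (derivSqNorm_bounds J (taylorPart_mem hf (k + J))).1

theorem hardyTail_le_weightedTail [NeZero n] (J : ℕ) {f : unitBall n → ℂ}
    (hf : IsHolomorphicOnBall f) {r : ℝ} (hr : 0 < r) :
    hardyTail J r (zeroExt f) ≤ (n : ℝ≥0∞) ^ J * weightedTail J r f := by
  rw [weightedTail_eq J hf hr, ← ENNReal.tsum_mul_left]
  refine ENNReal.tsum_le_tsum fun k => ?_
  rw [mul_comm (gradientFactor n k J : ℝ≥0∞), mul_assoc,
    mul_left_comm ((n : ℝ≥0∞) ^ J) (tailWeight n J k r)]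
  refine mul_le_mul_right ?_ _
  exact (derivSqNorm_bounds J (taylorPart_mem hf (k + J))).2

theorem le_gradientFactor [NeZero n] (k J : ℕ) : (k + 1) ^ (2 * J) ≤ gradientFactor n k J := by
  have hn := Nat.pos_of_ne_zero (NeZero.ne n)
  rw [pow_mul, gradientFactor]
  calc ((k + 1) ^ 2) ^ J = ∏ _j ∈ Finset.range J, (k + 1) ^ 2 := by simp
    _ ≤ _ := Finset.prod_le_prod' fun j _ => by
      rw [sq]; exact Nat.mul_le_mul (by omega) (by omega)

theorem gradientFactor_le [NeZero n] (k J : ℕ) :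
    gradientFactor n k J ≤ ((n + J) * (k + 1)) ^ (2 * J) := by
  have hn := Nat.pos_of_ne_zero (NeZero.ne n)
  rw [pow_mul, gradientFactor]
  calc _ ≤ ∏ _j ∈ Finset.range J, ((n + J) * (k + 1)) ^ 2 := Finset.prod_le_prod' fun j hj => by
        have hj' := Finset.mem_range.mp hj
        rw [sq]
        exact Nat.mul_le_mul (by nlinarith) (by nlinarith)
    _ = _ := by simp

theorem lintegral_pow_mul_exp {m : ℕ} (hm : 1 ≤ m) {a : ℝ} (ha : 0 < a) :
    ∫⁻ t in Set.Ioi (0 : ℝ), ENNReal.ofReal (t ^ (m - 1) * Real.exp (-(a * t))) =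
      ENNReal.ofReal ((m - 1).factorial / a ^ m) := by
  have h1 := Real.integral_rpow_mul_exp_neg_mul_Ioi (a := m) (r := a)
    (by exact_mod_cast hm) ha
  have h2 : (m : ℝ) - 1 = ((m - 1 : ℕ) : ℝ) := by rw [Nat.cast_sub hm]; simp
  have h3 : Real.Gamma (m : ℝ) = (m - 1).factorial := by
    rw [← Real.Gamma_nat_eq_factorial, ← h2]; ring_nf
  rw [h3, h2] at h1
  simp only [Real.rpow_natCast] at h1
  have h4 : IntegrableOn (fun t : ℝ => t ^ (m - 1) * Real.exp (-(a * t))) (Set.Ioi 0) := by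
    refine Integrable.of_integral_ne_zero ?_
    rw [h1]; positivity
  rw [← ofReal_integral_eq_lintegral_ofReal h4 (by
    filter_upwards [ae_restrict_mem measurableSet_Ioi] with t ht
    have : 0 < t := ht
    positivity), h1]
  congr 1
  rw [one_div, inv_pow]
  ring

theorem lintegral_Ico_reflect_le (h : ℝ → ℝ≥0∞) (r : ℝ) :
    ∫⁻ t in Set.Ico r 1, h (1 - t) ≤ ∫⁻ s in Set.Ioi (0 : ℝ), h s := by
  rw [← lintegral_indicator measurableSet_Ico, ← lintegral_indicator measurableSet_Ioi,
    ← lintegral_sub_left_eq_self ((Set.Ioi (0 : ℝ)).indicator h) (1 : ℝ)]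
  refine lintegral_mono fun t => ?_
  by_cases ht : t ∈ Set.Ico r 1
  · rw [Set.indicator_of_mem ht, Set.indicator_of_mem (by exact sub_pos.mpr ht.2)]
  · rw [Set.indicator_of_notMem ht]
    exact zero_le

/-- Uses `t ≤ exp(-(1-t))`, `1 - t² ≤ 2(1-t)` and `2(n+k)-1 ≥ k+1`. The substitution `s = 1 - t`
then leads to a Gamma integral of size `(k+1)^{-2J}`. -/
theorem tailWeight_integrand_le [NeZero n] {J k : ℕ} {t : ℝ} (h0 : 0 ≤ t) (h1 : t ≤ 1) :
    t ^ (2 * (n + k) - 1) * (1 - t ^ 2) ^ (2 * J - 1) ≤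
      2 ^ (2 * J - 1) * ((1 - t) ^ (2 * J - 1) * Real.exp (-((k + 1) * (1 - t)))) := by
  have hn := Nat.pos_of_ne_zero (NeZero.ne n)
  have h2 : t ^ (2 * (n + k) - 1) ≤ Real.exp (-((k + 1) * (1 - t))) := by
    calc t ^ (2 * (n + k) - 1) ≤ t ^ (k + 1) := pow_le_pow_of_le_one h0 h1 (by omega)
      _ ≤ (Real.exp (-(1 - t))) ^ (k + 1) := by
          gcongr
          have := Real.add_one_le_exp (-(1 - t))
          linarith
      _ = _ := by rw [← Real.exp_nat_mul]; push_cast; ring_nf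
  have h3 : (1 - t ^ 2) ^ (2 * J - 1) ≤ (2 * (1 - t)) ^ (2 * J - 1) := by
    apply pow_le_pow_left₀ <;> nlinarith
  calc _ ≤ Real.exp (-((k + 1) * (1 - t))) * (2 * (1 - t)) ^ (2 * J - 1) := by
        apply mul_le_mul h2 h3 (pow_nonneg (by nlinarith) _) (Real.exp_pos _).le
    _ = _ := by rw [mul_pow]; ring

/-- The growth `(k+1)^{2J}` of the derivative factor is cancelled exactly by the Gamma integral
`(2J-1)!/(k+1)^{2J}`; this is the role of the exponent `2J-1` in the weight. -/
theorem gradientFactor_mul_tailWeight_le [NeZero n] {J : ℕ} (hJ : 1 ≤ J) :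
    ∃ C : ℝ≥0∞, C ≠ ∞ ∧ ∀ k, ∀ r : ℝ, 0 < r → gradientFactor n k J * tailWeight n J k r ≤ C := by
  refine ⟨((n + J : ℕ) : ℝ≥0∞) ^ (2 * J) * (2 * n * (2 ^ (2 * J - 1) *
    ENNReal.ofReal (2 * J - 1).factorial)), ?_, fun k r hr => ?_⟩
  · finiteness
  have h1 : tailWeight n J k r ≤ 2 * n * (2 ^ (2 * J - 1) *
      ENNReal.ofReal ((2 * J - 1).factorial / ((k : ℝ) + 1) ^ (2 * J))) := by
    rw [tailWeight]
    gcongr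
    rw [← lintegral_pow_mul_exp (m := 2 * J) (by omega) (by positivity : (0 : ℝ) < (k : ℝ) + 1)]
    refine le_trans ?_ (mul_le_mul_right (lintegral_Ico_reflect_le
      (fun s => ENNReal.ofReal (s ^ (2 * J - 1) * Real.exp (-(((k : ℝ) + 1) * s)))) r) _)
    rw [← lintegral_const_mul _ (by fun_prop)]
    refine setLIntegral_mono (by fun_prop) fun t ht => ?_
    have ht0 : 0 ≤ t := hr.le.trans ht.1
    rw [← ENNReal.ofReal_mul (by positivity)]
    refine (ENNReal.ofReal_le_ofReal (tailWeight_integrand_le ht0 ht.2.le)).trans_eq ?_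
    rw [ENNReal.ofReal_mul (by positivity), ENNReal.ofReal_pow (by norm_num)]
    norm_num
  have h2 : (gradientFactor n k J : ℝ≥0∞) ≤
      ((n + J : ℕ) : ℝ≥0∞) ^ (2 * J) * ENNReal.ofReal (((k : ℝ) + 1) ^ (2 * J)) := by
    have h3 := gradientFactor_le (n := n) k J
    have h4 : ENNReal.ofReal (((k : ℝ) + 1) ^ (2 * J)) = (((k + 1) ^ (2 * J) : ℕ) : ℝ≥0∞) := by
      rw [← ENNReal.ofReal_natCast]; push_cast; rfl
    rw [h4, mul_pow] at *
    exact_mod_cast h3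
  have h5 : ENNReal.ofReal (((k : ℝ) + 1) ^ (2 * J)) *
      ENNReal.ofReal ((2 * J - 1).factorial / ((k : ℝ) + 1) ^ (2 * J)) =
      ENNReal.ofReal (2 * J - 1).factorial := by
    rw [← ENNReal.ofReal_mul (by positivity), mul_div_cancel₀]
    positivity
  refine (mul_le_mul' h2 h1).trans_eq ?_
  rw [← h5]
  ring

theorem le_tailWeight_integrand [NeZero n] {J k : ℕ} {t : ℝ} (h0 : 1 - 2 / ((k : ℝ) + 3) ≤ t)
    (h1 : t ≤ 1 - 1 / ((k : ℝ) + 3)) :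
    Real.exp (-(4 * n)) * (1 / ((k : ℝ) + 3)) ^ (2 * J - 1) ≤
      t ^ (2 * (n + k) - 1) * (1 - t ^ 2) ^ (2 * J - 1) := by
  have hn : 1 ≤ (n : ℝ) := by exact_mod_cast Nat.pos_of_ne_zero (NeZero.ne n)
  have hk : (0 : ℝ) ≤ k := Nat.cast_nonneg k
  -- The shift by `3` keeps the left endpoint positive even for `k = 0` and makes its inverse `1 +
  -- 2/(k+1)`, which is at most `exp(2/(k+1))`. The bound `n + k ≤ n(k+1)` then yields `exp(-4n)`.
  have hq : 1 - 2 / ((k : ℝ) + 3) = (1 + 2 / ((k : ℝ) + 1))⁻¹ := by field_simp; ring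
  have hq0 : 0 < 1 - 2 / ((k : ℝ) + 3) := by rw [hq]; positivity
  have ht0 : 0 < t := hq0.trans_le h0
  have hm : 0 < 1 / ((k : ℝ) + 3) := by positivity
  have ht1 : t ≤ 1 := by linarith
  have h2 : (1 / ((k : ℝ) + 3)) ^ (2 * J - 1) ≤ (1 - t ^ 2) ^ (2 * J - 1) := by
    apply pow_le_pow_left₀ hm.le
    nlinarith
  have h3 : Real.exp (-(4 * n)) ≤ t ^ (2 * (n + k) - 1) := by
    calc Real.exp (-(4 * n)) ≤ Real.exp (-(2 / ((k : ℝ) + 1)) * (2 * (n + k) : ℕ)) := by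
          rw [Real.exp_le_exp, neg_mul, neg_le_neg_iff, div_mul_eq_mul_div, div_le_iff₀ (by positivity)]
          push_cast
          nlinarith
      _ = (Real.exp (2 / ((k : ℝ) + 1)))⁻¹ ^ (2 * (n + k)) := by
          rw [← Real.exp_neg, ← Real.exp_nat_mul, mul_comm]
      _ ≤ (1 - 2 / ((k : ℝ) + 3)) ^ (2 * (n + k)) := by
          rw [hq]
          gcongr
          have := Real.add_one_le_exp (2 / ((k : ℝ) + 1))
          linarith
      _ ≤ t ^ (2 * (n + k)) := by gcongr
      _ ≤ _ := pow_le_pow_of_le_one ht0.le ht1 (Nat.sub_le _ _)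
  exact mul_le_mul h3 h2 (by positivity) (by positivity)

/-- The integral defining `tailWeight` is of size `k^{-2J}` already on a window of length `1/(k+3)`
at distance `1/(k+3)` from `1`. For large `k` this window lies in `[r,1)`, so `r` affects only the
threshold `K` and not `c`. -/
theorem le_gradientFactor_mul_tailWeight [NeZero n] {J : ℕ} (hJ : 1 ≤ J) :
    ∃ c : ℝ≥0∞, c ≠ 0 ∧ c ≠ ∞ ∧ ∀ r : ℝ, r < 1 → ∃ K : ℕ, ∀ k, K ≤ k →
      c ≤ gradientFactor n k J * tailWeight n J k r := by
  have hn : 1 ≤ n := Nat.pos_of_ne_zero (NeZero.ne n)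
  -- The factor `1/3` is the minimum of `(k+1)/(k+3)`; the threshold ensures `2/(k+3) ≤ 1 - r`.
  refine ⟨ENNReal.ofReal (Real.exp (-(4 * n)) * (1 / 3) ^ (2 * J)), ?_, ENNReal.ofReal_ne_top,
    fun r hr => ⟨⌈2 / (1 - r)⌉₊, fun k hk => ?_⟩⟩
  · rw [ne_eq, ENNReal.ofReal_eq_zero, not_le]
    positivity
  have hr' : 0 < 1 - r := by linarith
  have hkr : r ≤ 1 - 2 / ((k : ℝ) + 3) := by
    have h1 : 2 / (1 - r) ≤ k := Nat.ceil_le.mp hk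
    rw [div_le_iff₀ hr'] at h1
    have h2 : 2 / ((k : ℝ) + 3) ≤ 1 - r := by
      rw [div_le_iff₀ (by positivity)]
      nlinarith
    linarith
  have hm : 0 < 1 / ((k : ℝ) + 3) := by positivity
  have hsub : Set.Icc (1 - 2 / ((k : ℝ) + 3)) (1 - 1 / ((k : ℝ) + 3)) ⊆ Set.Ico r 1 :=
    fun t ht => ⟨hkr.trans ht.1, by linarith [ht.2]⟩
  have hpos : 0 < 1 - 2 / ((k : ℝ) + 3) := by
    rw [sub_pos, div_lt_one (by positivity)]
    have : (0 : ℝ) ≤ k := Nat.cast_nonneg k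
    linarith
  have h1 : ENNReal.ofReal (Real.exp (-(4 * n)) * (1 / ((k : ℝ) + 3)) ^ (2 * J)) ≤
      tailWeight n J k r := by
    have h2 : ∫⁻ _t in Set.Icc (1 - 2 / ((k : ℝ) + 3)) (1 - 1 / ((k : ℝ) + 3)),
        ENNReal.ofReal (Real.exp (-(4 * n)) * (1 / ((k : ℝ) + 3)) ^ (2 * J - 1)) =
        ENNReal.ofReal (Real.exp (-(4 * n)) * (1 / ((k : ℝ) + 3)) ^ (2 * J)) := by
      rw [setLIntegral_const, Real.volume_Icc, ← ENNReal.ofReal_mul (by positivity)]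
      congr 1
      have h3 : 2 * J = (2 * J - 1) + 1 := by omega
      conv_rhs => rw [h3, pow_succ]
      ring
    rw [← h2, tailWeight]
    refine le_trans ?_ (le_mul_of_one_le_left' (by
      have : (1 : ℝ≥0∞) ≤ n := by exact_mod_cast hn
      calc (1 : ℝ≥0∞) = 1 * 1 := by ring
        _ ≤ 2 * n := by gcongr; norm_num))
    refine le_trans ?_ (lintegral_mono_set hsub)
    refine setLIntegral_mono (by fun_prop) fun t ht => ?_
    rw [← ENNReal.ofReal_mul (pow_nonneg (hpos.le.trans ht.1) _)]
    exact ENNReal.ofReal_le_ofReal (le_tailWeight_integrand ht.1 ht.2)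
  have h2 : ENNReal.ofReal (((k : ℝ) + 1) ^ (2 * J)) ≤ gradientFactor n k J := by
    have h3 := le_gradientFactor (n := n) k J
    have h4 : ENNReal.ofReal (((k : ℝ) + 1) ^ (2 * J)) = (((k + 1) ^ (2 * J) : ℕ) : ℝ≥0∞) := by
      rw [← ENNReal.ofReal_natCast]; push_cast; rfl
    rw [h4]
    exact_mod_cast h3
  refine le_trans ?_ (mul_le_mul' h2 h1)
  rw [← ENNReal.ofReal_mul (by positivity), mul_left_comm, ← mul_pow]
  refine ENNReal.ofReal_le_ofReal ?_
  gcongr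
  rw [mul_one_div, div_le_div_iff₀ (by norm_num) (by positivity)]
  have : (0 : ℝ) ≤ k := Nat.cast_nonneg k
  linarith

end TailWeight

/-! ### Boundedness of point evaluations on the Hardy space. -/

section PointEvaluation

variable {n : ℕ}

/-- The sub-mean-value property: after translation and dilation, the left side is the degree-zero
term of the Parseval sum. -/
theorem enorm_sq_le_lintegral_sphere [NeZero n] {f : Cn n → ℂ} {z : Cn n} {δ t : ℝ}
    (hf : DifferentiableOn ℂ f (ball z δ)) (ht : t ∈ Set.Ioo 0 δ) :
    ‖f z‖ₑ ^ 2 ≤ ∫⁻ ζ : sphere (0 : Cn n) 1, ‖f (z + t • (ζ : Cn n))‖ₑ ^ 2 ∂(sphereMeasure n) := by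
  have hδ : 0 < δ := ht.1.trans ht.2
  have hg : DifferentiableOn ℂ (fun w => f (z + (δ : ℂ) • w)) (unitBall n) := by
    refine hf.comp (by fun_prop) fun w hw => ?_
    have hw1 : ‖w‖ < 1 := by simpa using hw
    rw [mem_ball, dist_eq_norm, add_sub_cancel_left, norm_smul, Complex.norm_real,
      Real.norm_of_nonneg hδ.le]
    nlinarith
  have h := lintegral_sphere_dilate hg (r := t / δ)
    ⟨div_pos ht.1 hδ, (div_lt_one hδ).mpr ht.2⟩
  have h1 : ∀ ζ : sphere (0 : Cn n) 1, z + (δ : ℂ) • (t / δ) • (ζ : Cn n) = z + t • (ζ : Cn n) := by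
    intro ζ
    rw [Complex.coe_smul, smul_smul, mul_div_cancel₀ _ hδ.ne']
  simp only [h1] at h
  rw [h]
  refine le_trans (le_of_eq ?_) (ENNReal.le_tsum 0)
  have h2 : taylorPart 0 (fun w : Cn n => f (z + (δ : ℂ) • w)) = fun _ => f z := by
    funext w; simp [taylorPart]
  rw [h2, sphereSqNorm]
  simp

theorem lintegral_sphere_le_hardyENorm_sq [NeZero n] {f : unitBall n → ℂ}
    (hf : IsHolomorphicOnBall f) {r : ℝ} (hr : r ∈ Set.Ioo (0 : ℝ) 1) :
    ∫⁻ ζ : sphere (0 : Cn n) 1, ‖zeroExt f (r • (ζ : Cn n))‖ₑ ^ 2 ∂(sphereMeasure n) ≤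
      hardyENorm f ^ 2 := by
  rw [hardyENorm_sq hf, ← iSup_tsum_ofReal_pow_mul, lintegral_sphere_dilate hf hr]
  exact le_iSup₂ (f := fun (r : ℝ) (_ : r ∈ Set.Ioo (0 : ℝ) 1) =>
    ∑' k : ℕ, ENNReal.ofReal (r ^ (2 * k)) * sphereSqNorm (taylorPart k (zeroExt f))) r hr

theorem measurable_zeroExt {f : unitBall n → ℂ} (hf : IsHolomorphicOnBall f) :
    Measurable (zeroExt f) := by
  classical
  have h : zeroExt f = (unitBall n).piecewise (zeroExt f) 0 := by
    funext z
    by_cases hz : z ∈ unitBall n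
    · rw [Set.piecewise_eq_of_mem _ _ _ hz]
    · rw [Set.piecewise_eq_of_notMem _ _ _ hz]
      simp only [zeroExt, dif_neg hz, Pi.zero_apply]
  rw [h]
  exact hf.continuousOn.measurable_piecewise continuousOn_const measurableSet_ball

theorem lintegral_zeroExt_le [NeZero n] {f : unitBall n → ℂ} (hf : IsHolomorphicOnBall f) :
    ∫⁻ z, ‖zeroExt f z‖ₑ ^ 2 ≤
      (volume : Measure (Cn n)).toSphere Set.univ * hardyENorm f ^ 2 := by
  have hm := measurable_zeroExt hf
  rw [lintegral_polar (by fun_prop)]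
  gcongr
  have h1 : ∀ t ∈ Set.Ioi (0 : ℝ), ENNReal.ofReal (t ^ (2 * n - 1)) *
      ∫⁻ ζ : sphere (0 : Cn n) 1, ‖zeroExt f (t • (ζ : Cn n))‖ₑ ^ 2 ∂(sphereMeasure n) ≤
      (Set.Iio (1 : ℝ)).indicator (fun _ => hardyENorm f ^ 2) t := by
    intro t (ht : 0 < t)
    by_cases ht1 : t < 1
    · rw [Set.indicator_of_mem (by exact ht1)]
      refine (mul_le_of_le_one_left' ?_).trans (lintegral_sphere_le_hardyENorm_sq hf ⟨ht, ht1⟩)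
      rw [ENNReal.ofReal_le_one]
      exact pow_le_one₀ ht.le ht1.le
    · have h2 : ∀ ζ : sphere (0 : Cn n) 1, zeroExt f (t • (ζ : Cn n)) = 0 := fun ζ => by
        rw [zeroExt, dif_neg]
        rw [mem_ball_zero_iff, norm_smul, norm_eq_of_mem_sphere, mul_one,
          Real.norm_of_nonneg ht.le]
        exact ht1
      simp [h2]
  refine (setLIntegral_mono' measurableSet_Ioi h1).trans ?_
  rw [setLIntegral_indicator measurableSet_Iio, setLIntegral_const, Set.inter_comm, Set.Ioi_inter_Iio,
    Real.volume_Ioo]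
  simp

/-- Integrating the sub-mean-value property over radii in `(0, 1 - R)` bounds the value at `z` by
the `L²` norm on the whole ball, which the Hardy norm controls. -/
theorem exists_enorm_sq_zeroExt_le [NeZero n] {R : ℝ} (hR : R < 1) :
    ∃ C : ℝ≥0∞, C ≠ ∞ ∧ ∀ f : unitBall n → ℂ, IsHolomorphicOnBall f → ∀ z ∈ ball (0 : Cn n) R,
      ‖zeroExt f z‖ₑ ^ 2 ≤ C * hardyENorm f ^ 2 := by
  set m : ℝ≥0∞ := ∫⁻ t in Set.Ioo 0 (1 - R), ENNReal.ofReal (t ^ (2 * n - 1)) with hm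
  have hm0 : m ≠ 0 := by
    rw [hm, ne_eq, lintegral_eq_zero_iff (by fun_prop)]
    intro h
    rw [EventuallyEq, ae_restrict_iff' measurableSet_Ioo] at h
    have h1 : ∀ᵐ t : ℝ, t ∉ Set.Ioo 0 (1 - R) := by
      filter_upwards [h] with t ht hmem
      have h2 := ht hmem
      simp only [Pi.zero_apply, ENNReal.ofReal_eq_zero] at h2
      have := pow_pos hmem.1 (2 * n - 1)
      linarith
    have h2 := measure_eq_zero_iff_ae_notMem.mpr h1
    rw [Real.volume_Ioo, ENNReal.ofReal_eq_zero] at h2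
    linarith
  have hmt : m ≠ ∞ := by
    have h3 : m ≤ ENNReal.ofReal ((1 - R) ^ (2 * n - 1)) * ENNReal.ofReal (1 - R) := by
      rw [hm]
      refine (setLIntegral_mono' (g := fun _ => ENNReal.ofReal ((1 - R) ^ (2 * n - 1)))
        measurableSet_Ioo fun t ht => ?_).trans_eq ?_
      · exact ENNReal.ofReal_le_ofReal (pow_le_pow_left₀ ht.1.le ht.2.le _)
      · rw [setLIntegral_const, Real.volume_Ioo, sub_zero]
    exact ne_top_of_le_ne_top (ENNReal.mul_ne_top ENNReal.ofReal_ne_top ENNReal.ofReal_ne_top) h3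
  refine ⟨m⁻¹, ENNReal.inv_ne_top.mpr hm0, fun f hf z hz => ?_⟩
  have hz1 : ‖z‖ < R := by simpa using hz
  have hsub : ball z (1 - R) ⊆ unitBall n := ball_subset_ball' (by rw [dist_zero_right]; linarith)
  have hfm := measurable_zeroExt hf
  set σ := (volume : Measure (Cn n)).toSphere Set.univ with hσ
  have h1 : σ * (m * ‖zeroExt f z‖ₑ ^ 2) ≤ ∫⁻ w, ‖zeroExt f (z + w)‖ₑ ^ 2 := by
    rw [lintegral_polar (by fun_prop)]
    gcongr
    rw [hm, ← lintegral_mul_const _ (by fun_prop)]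
    refine le_trans ?_ (lintegral_mono_set (s := Set.Ioo 0 (1 - R)) fun t ht => ht.1)
    refine setLIntegral_mono' measurableSet_Ioo fun t ht => ?_
    gcongr
    exact enorm_sq_le_lintegral_sphere (hf.mono hsub) ht
  rw [lintegral_add_left_eq_self (fun w => ‖zeroExt f w‖ₑ ^ 2) z] at h1
  have h2 := h1.trans (lintegral_zeroExt_le hf)
  rw [ENNReal.mul_le_mul_iff_right toSphere_univ_ne_zero (measure_ne_top _ _)] at h2
  exact (ENNReal.mul_le_iff_le_inv hm0 hmt).mp h2

end PointEvaluation

/-! ### Completeness of the Hardy space. -/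

section Completeness

variable {n : ℕ}

/-- A function in the Hardy submodule as an element of the Hardy space. -/
def HardySpace.ofMem (f : unitBall n → ℂ) (hf : f ∈ hardySubmodule n) : HardySpace n := ⟨f, hf⟩

theorem HardySpace.isHolomorphicOnBall (f : HardySpace n) : IsHolomorphicOnBall f.toFun := f.2.1

theorem HardySpace.ofReal_norm [NeZero n] (f : HardySpace n) :
    ENNReal.ofReal ‖f‖ = hardyENorm f.toFun :=
  ENNReal.ofReal_toReal f.2.2.ne

theorem HardySpace.zeroExt_sub (f g : HardySpace n) :
    zeroExt (f - g).toFun = zeroExt f.toFun - zeroExt g.toFun := by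
  have h : (f - g).toFun = f.toFun + (-1 : ℂ) • g.toFun := by
    change f.toFun - g.toFun = _
    rw [neg_one_smul, sub_eq_add_neg]
  rw [h, zeroExt_add, zeroExt_smul, neg_one_smul, ← sub_eq_add_neg]

theorem HardySpace.exists_norm_zeroExt_le [NeZero n] {R : ℝ} (hR : R < 1) :
    ∃ C : ℝ, 0 ≤ C ∧ ∀ f : HardySpace n, ∀ z ∈ ball (0 : Cn n) R,
      ‖zeroExt f.toFun z‖ ≤ C * ‖f‖ := by
  obtain ⟨C, hC, h⟩ := exists_enorm_sq_zeroExt_le (n := n) hR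
  refine ⟨√C.toReal, Real.sqrt_nonneg _, fun f z hz => ?_⟩
  have h1 := h f.toFun f.isHolomorphicOnBall z hz
  rw [← f.ofReal_norm, ← _root_.ofReal_norm, ← ENNReal.ofReal_pow (norm_nonneg _),
    ← ENNReal.ofReal_pow (norm_nonneg _), ← ENNReal.ofReal_toReal hC,
    ← ENNReal.ofReal_mul ENNReal.toReal_nonneg,
    ENNReal.ofReal_le_ofReal_iff (by positivity)] at h1
  refine le_of_sq_le_sq ?_ (by positivity)
  rw [mul_pow, Real.sq_sqrt ENNReal.toReal_nonneg]
  exact h1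

theorem HardySpace.exists_norm_fderiv_zeroExt_le [NeZero n] {R : ℝ} (hR : R < 1) :
    ∃ C : ℝ, 0 ≤ C ∧ ∀ f : HardySpace n, ∀ z ∈ ball (0 : Cn n) R,
      ‖fderiv ℂ (zeroExt f.toFun) z‖ ≤ C * ‖f‖ := by
  -- The midpoint between `R` and `1` leaves a margin `(1 - R)/2` for the Cauchy estimate.
  obtain ⟨C, hC0, hC⟩ := HardySpace.exists_norm_zeroExt_le (n := n) (R := (1 + R) / 2) (by linarith)
  refine ⟨2 * C / ((1 - R) / 2), div_nonneg (by positivity) (by linarith), fun f z hz => ?_⟩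
  have hz1 : ‖z‖ < R := by simpa using hz
  have hsub : ball z ((1 - R) / 2) ⊆ ball 0 ((1 + R) / 2) :=
    ball_subset_ball' (by rw [dist_zero_right]; linarith)
  have h := norm_fderiv_le_of_norm_le_on_ball (f := zeroExt f.toFun) (z := z) (δ := (1 - R) / 2)
    (M := C * ‖f‖) (by linarith)
    (f.isHolomorphicOnBall.mono (hsub.trans (ball_subset_ball (by linarith))))
    fun w hw => hC f w (hsub hw)
  refine h.trans_eq ?_
  ring

theorem uniformCauchySeqOn_of_norm_sub_le {X Y V : Type*} [SeminormedAddCommGroup V]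
    [SeminormedAddCommGroup Y] {s : Set X} {L : V → X → Y} {C : ℝ} (hC : 0 ≤ C)
    (hL : ∀ u v, ∀ x ∈ s, ‖L u x - L v x‖ ≤ C * ‖u - v‖) {u : ℕ → V} (hu : CauchySeq u) :
    UniformCauchySeqOn (fun j x => L (u j) x) atTop s := by
  rw [Metric.uniformCauchySeqOn_iff]
  intro ε hε
  obtain ⟨N, hN⟩ := Metric.cauchySeq_iff.mp hu (ε / (C + 1)) (by positivity)
  refine ⟨N, fun i hi j hj x hx => ?_⟩
  rw [dist_eq_norm]
  have h1 := hN i hi j hj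
  rw [dist_eq_norm, lt_div_iff₀ (by positivity)] at h1
  have h2 := hL (u i) (u j) x hx
  nlinarith [norm_nonneg (u i - u j)]

/-- Point evaluations give pointwise limits; the derivative bounds make the derivatives uniformly
Cauchy on smaller balls, so the limit is differentiable there. -/
theorem HardySpace.exists_holomorphic_limit [NeZero n] {u : ℕ → HardySpace n} (hu : CauchySeq u) :
    ∃ g : unitBall n → ℂ, IsHolomorphicOnBall g ∧
      ∀ z ∈ unitBall n, Tendsto (fun j => zeroExt (u j).toFun z) atTop (𝓝 (zeroExt g z)) := by
  have hR : ∀ z ∈ unitBall n, ∃ R < 1, z ∈ ball (0 : Cn n) R := fun z hz => by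
    have hz1 : ‖z‖ < 1 := by simpa using hz
    exact ⟨(1 + ‖z‖) / 2, by linarith, by rw [mem_ball_zero_iff]; linarith⟩
  have hlim : ∀ z : unitBall n, ∃ a, Tendsto (fun j => zeroExt (u j).toFun z) atTop (𝓝 a) := by
    rintro ⟨z, hz⟩
    obtain ⟨R, hR1, hzR⟩ := hR z hz
    obtain ⟨C, hC0, hC⟩ := HardySpace.exists_norm_zeroExt_le (n := n) hR1
    exact cauchySeq_tendsto_of_complete ((uniformCauchySeqOn_of_norm_sub_le hC0
      (L := fun f : HardySpace n => zeroExt f.toFun) (fun f g x hx => by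
        have := hC (f - g) x hx
        rwa [HardySpace.zeroExt_sub] at this) hu).cauchySeq hzR)
  choose g hg using hlim
  have hg' : ∀ z ∈ unitBall n, Tendsto (fun j => zeroExt (u j).toFun z) atTop (𝓝 (zeroExt g z)) :=
    fun z hz => by rw [zeroExt_of_mem g hz]; exact hg ⟨z, hz⟩
  refine ⟨g, fun z hz => ?_, hg'⟩
  obtain ⟨R, hR1, hzR⟩ := hR z hz
  obtain ⟨C, hC0, hC⟩ := HardySpace.exists_norm_fderiv_zeroExt_le (n := n) hR1
  have hsub : ball (0 : Cn n) R ⊆ unitBall n := ball_subset_ball hR1.le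
  have hdiff : ∀ (f : HardySpace n), ∀ x ∈ ball (0 : Cn n) R,
      HasFDerivAt (zeroExt f.toFun) (fderiv ℂ (zeroExt f.toFun) x) x := fun f x hx =>
    (f.isHolomorphicOnBall.differentiableAt (isOpen_ball.mem_nhds (hsub hx))).hasFDerivAt
  have huc := uniformCauchySeqOn_of_norm_sub_le hC0 (s := ball (0 : Cn n) R)
    (L := fun (f : HardySpace n) x => fderiv ℂ (zeroExt f.toFun) x) (fun f h x hx => by
      have := hC (f - h) x hx
      rwa [HardySpace.zeroExt_sub, ((hdiff f x hx).sub (hdiff h x hx)).fderiv] at this) hu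
  have hlim' : ∀ x : ball (0 : Cn n) R, ∃ a,
      Tendsto (fun j => fderiv ℂ (zeroExt (u j).toFun) x) atTop (𝓝 a) := fun x =>
    cauchySeq_tendsto_of_complete (huc.cauchySeq x.2)
  choose g' hg'' using hlim'
  classical
  let G' : Cn n → Cn n →L[ℂ] ℂ := fun x => if h : x ∈ ball (0 : Cn n) R then g' ⟨x, h⟩ else 0
  have hunif := huc.tendstoUniformlyOn_of_tendsto (f := G') fun x hx => by
    simp only [G', dif_pos hx]
    exact hg'' ⟨x, hx⟩
  exact (hasFDerivAt_of_tendstoUniformlyOn isOpen_ball hunif (fun j x hx => hdiff (u j) x hx)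
    (fun x hx => hg' x (hsub hx)) hzR).differentiableAt.differentiableWithinAt

instance HardySpace.instCompleteSpace (n : ℕ) [NeZero n] : CompleteSpace (HardySpace n) := by
  refine Metric.complete_of_cauchySeq_tendsto fun u hu => ?_
  obtain ⟨g, hg, hlim⟩ := HardySpace.exists_holomorphic_limit hu
  have key : ∀ ε : ℝ, 0 < ε → ∃ N, ∀ j, N ≤ j →
      hardyENorm ((u j).toFun + (-1 : ℂ) • g) ≤ ENNReal.ofReal ε := by
    intro ε hε
    obtain ⟨N, hN⟩ := Metric.cauchySeq_iff.mp hu ε hε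
    refine ⟨N, fun j hj => ?_⟩
    rw [hardyENorm_eq]
    refine iSup₂_le fun r hr => ?_
    -- Fatou's lemma on each sphere passes the Cauchy bound for `u j - u i` to the pointwise limit
    -- in `i`.
    refine (Lp.eLpNorm_lim_le_liminf_eLpNorm
      (f := fun i (ζ : sphere (0 : Cn n) 1) => zeroExt (u j - u i).toFun (r • (ζ : Cn n)))
      (fun i => ((u j - u i).isHolomorphicOnBall.continuous_dilate hr).aestronglyMeasurable) _
      (ae_of_all _ fun ζ => ?_)).trans ?_
    · simp only [HardySpace.zeroExt_sub, zeroExt_add, zeroExt_smul]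
      simp only [Pi.sub_apply, Pi.add_apply, neg_one_smul]
      exact tendsto_const_nhds.sub (hlim _ (smul_mem_unitBall hr ζ))
    · refine liminf_le_of_frequently_le' (Eventually.frequently ?_)
      filter_upwards [eventually_ge_atTop N] with i hi
      have h1 : eLpNorm (fun ζ : sphere (0 : Cn n) 1 => zeroExt (u j - u i).toFun (r • (ζ : Cn n)))
          2 (sphereMeasure n) ≤ hardyENorm (u j - u i).toFun := by
        rw [hardyENorm_eq]
        exact le_iSup₂ (f := fun (r : ℝ) (_ : r ∈ Set.Ioo (0 : ℝ) 1) => eLpNorm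
          (fun ζ : sphere (0 : Cn n) 1 => zeroExt (u j - u i).toFun (r • (ζ : Cn n))) 2
          (sphereMeasure n)) r hr
      refine h1.trans ?_
      rw [← HardySpace.ofReal_norm, ← dist_eq_norm]
      exact ENNReal.ofReal_le_ofReal (hN j hj i hi).le
  have hmem : g ∈ hardySubmodule n := by
    obtain ⟨N, hN⟩ := key 1 one_pos
    have h1 : (u N).toFun + (-1 : ℂ) • g ∈ hardySubmodule n :=
      ⟨(u N).isHolomorphicOnBall.add (hg.smul _), (hN N le_rfl).trans_lt ENNReal.ofReal_lt_top⟩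
    have h2 := (hardySubmodule n).sub_mem (u N).2 h1
    have h3 : (u N).toFun - ((u N).toFun + (-1 : ℂ) • g) = g := by
      rw [neg_one_smul]; abel
    exact h3 ▸ h2
  refine ⟨HardySpace.ofMem g hmem, Metric.tendsto_atTop.mpr fun ε hε => ?_⟩
  obtain ⟨N, hN⟩ := key (ε / 2) (half_pos hε)
  refine ⟨N, fun j hj => ?_⟩
  have h1 := hN j hj
  have h2 : (u j).toFun + (-1 : ℂ) • g =
      (u j - HardySpace.ofMem g hmem).toFun := by
    rw [neg_one_smul, ← sub_eq_add_neg]; rfl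
  rw [h2, ← HardySpace.ofReal_norm, ENNReal.ofReal_le_ofReal_iff (half_pos hε).le] at h1
  rw [dist_eq_norm]
  exact h1.trans_lt (half_lt_self hε)

end Completeness

/-! ### Taylor polynomials and compactness of bounded sets of them. -/

section Truncation

variable {n : ℕ}

/-- By Euler's identity the gradient is injective in positive degree, so dimension bounds descend to
the constants without any basis of monomials. -/
theorem finiteDimensional_homogeneousHolomorphic (n k : ℕ) :
    FiniteDimensional ℂ (homogeneousHolomorphic n k) := by
  induction k with
  | zero =>
    let L : homogeneousHolomorphic n 0 →ₗ[ℂ] ℂ :=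
      { toFun := fun p => p.1 0, map_add' := fun _ _ => rfl, map_smul' := fun _ _ => rfl }
    refine FiniteDimensional.of_injective L fun p q h => Subtype.ext ?_
    rw [eq_const_of_mem_zero p.2, eq_const_of_mem_zero q.2]
    funext
    exact h
  | succ k ih =>
    let L : homogeneousHolomorphic n (k + 1) →ₗ[ℂ] (Fin n → homogeneousHolomorphic n k) :=
      { toFun := fun p i => ⟨complexPartial i p.1, complexPartial_mem p.2 i⟩
        map_add' := fun p q => by
          funext i
          ext z
          change fderiv ℂ (p.1 + q.1) z _ = _
          rw [fderiv_add (p.2.1 z) (q.2.1 z)]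
          rfl
        map_smul' := fun c p => by
          funext i
          ext z
          change fderiv ℂ (c • p.1) z _ = _
          rw [fderiv_const_smul (p.2.1 z)]
          rfl }
    refine FiniteDimensional.of_injective L fun p q h => Subtype.ext ?_
    funext z
    have h1 : ∀ i, complexPartial i p.1 = complexPartial i q.1 := fun i =>
      congrArg Subtype.val (congrFun h i)
    have h2 := sum_coord_mul_complexPartial p.2 z
    simp only [h1] at h2
    rw [sum_coord_mul_complexPartial q.2 z] at h2
    exact (mul_left_cancel₀ (by exact_mod_cast Nat.succ_ne_zero k) h2).symm

theorem zeroExt_restrict_eqOn (p : Cn n → ℂ) :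
    Set.EqOn (zeroExt fun z : unitBall n => p z) p (unitBall n) :=
  fun _ hz => zeroExt_of_mem _ hz

theorem restrict_mem_hardySubmodule [NeZero n] {k : ℕ} {p : Cn n → ℂ}
    (hp : p ∈ homogeneousHolomorphic n k) :
    (fun z : unitBall n => p z) ∈ hardySubmodule n := by
  have hh : IsHolomorphicOnBall fun z : unitBall n => p z :=
    hp.1.differentiableOn.congr (zeroExt_restrict_eqOn p)
  refine ⟨hh, ?_⟩
  refine (ENNReal.pow_lt_top_iff (n := 2).mp ?_).resolve_right two_ne_zero
  rw [hardyENorm_sq hh]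
  simp only [taylorPart_congr (zeroExt_restrict_eqOn p), taylorPart_of_mem hp]
  rw [tsum_eq_single k fun j hj => by simp [hj, sphereSqNorm], if_pos rfl, sphereSqNorm]
  obtain ⟨C, hC⟩ := exists_norm_le_of_mem hp
  refine (lintegral_mono (g := fun _ => ENNReal.ofReal C ^ 2) fun ζ => ?_).trans_lt ?_
  · refine pow_le_pow_left' ?_ 2
    rw [← ofReal_norm]
    refine ENNReal.ofReal_le_ofReal ((hC ζ).trans_eq ?_)
    rw [norm_eq_of_mem_sphere, one_pow, mul_one]
  · rw [lintegral_const, measure_univ, mul_one]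
    finiteness

/-- The restriction of homogeneous holomorphic functions to the unit ball. -/
def homogeneousToHardy (n k : ℕ) [NeZero n] : homogeneousHolomorphic n k →ₗ[ℂ] HardySpace n where
  toFun p := HardySpace.ofMem _ (restrict_mem_hardySubmodule p.2)
  map_add' _ _ := rfl
  map_smul' _ _ := rfl

/-- The homogeneous part of degree `k` as a linear map on the Hardy space. -/
def homogeneousPart (n k : ℕ) : HardySpace n →ₗ[ℂ] homogeneousHolomorphic n k where
  toFun f := ⟨taylorPart k (zeroExt f.toFun), taylorPart_mem f.isHolomorphicOnBall k⟩
  map_add' f g := Subtype.ext (by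
    change taylorPart k (zeroExt (f.toFun + g.toFun)) = _
    rw [zeroExt_add, taylorPart_add f.isHolomorphicOnBall g.isHolomorphicOnBall]
    rfl)
  map_smul' c f := Subtype.ext (by
    change taylorPart k (zeroExt (c • f.toFun)) = _
    rw [zeroExt_smul, taylorPart_const_smul f.isHolomorphicOnBall]
    rfl)

theorem HardySpace.ofReal_norm_sq [NeZero n] (f : HardySpace n) :
    ENNReal.ofReal ‖f‖ ^ 2 = ∑' k, sphereSqNorm (homogeneousPart n k f).1 := by
  rw [HardySpace.ofReal_norm, hardyENorm_sq f.isHolomorphicOnBall]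
  rfl

theorem homogeneousPart_homogeneousToHardy [NeZero n] {j k : ℕ} (p : homogeneousHolomorphic n k) :
    (homogeneousPart n j (homogeneousToHardy n k p)).1 = if j = k then p.1 else 0 := by
  change taylorPart j (zeroExt fun z : unitBall n => p.1 z) = _
  rw [taylorPart_congr (zeroExt_restrict_eqOn p.1), taylorPart_of_mem p.2]

/-- Sums of homogeneous functions of degree less than `K` in the Hardy space. -/
def polynomialToHardy (n K : ℕ) [NeZero n] :
    (∀ k : Fin K, homogeneousHolomorphic n k) →ₗ[ℂ] HardySpace n :=
  ∑ k : Fin K, homogeneousToHardy n k ∘ₗ LinearMap.proj k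

/-- The Taylor polynomial of degree less than `K`. -/
def taylorTruncation (K : ℕ) [NeZero n] (f : HardySpace n) : HardySpace n :=
  polynomialToHardy n K fun k => homogeneousPart n k f

theorem homogeneousPart_taylorTruncation [NeZero n] (K j : ℕ) (f : HardySpace n) :
    (homogeneousPart n j (taylorTruncation K f)).1 =
      if j < K then (homogeneousPart n j f).1 else 0 := by
  simp only [taylorTruncation, polynomialToHardy, LinearMap.sum_apply, LinearMap.comp_apply,
    LinearMap.proj_apply, map_sum, Submodule.coe_sum, homogeneousPart_homogeneousToHardy]
  split_ifs with h
  · rw [Finset.sum_eq_single (⟨j, h⟩ : Fin K)]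
    · simp
    · intro k _ hk
      rw [if_neg fun hjk => hk (Fin.ext hjk.symm)]
    · simp
  · refine Finset.sum_eq_zero fun k _ => ?_
    rw [if_neg fun hjk : j = (k : ℕ) => h (hjk.trans_lt k.2)]

theorem sphereSqNorm_zero : sphereSqNorm (0 : Cn n → ℂ) = 0 := by simp [sphereSqNorm]

theorem norm_taylorTruncation_le [NeZero n] (K : ℕ) (f : HardySpace n) :
    ‖taylorTruncation K f‖ ≤ ‖f‖ := by
  rw [← ENNReal.ofReal_le_ofReal_iff (norm_nonneg _), ← ENNReal.pow_le_pow_left_iff two_ne_zero,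
    HardySpace.ofReal_norm_sq, HardySpace.ofReal_norm_sq]
  refine ENNReal.tsum_le_tsum fun j => ?_
  rw [homogeneousPart_taylorTruncation]
  split_ifs
  · exact le_rfl
  · rw [sphereSqNorm_zero]; exact zero_le

theorem ofReal_norm_sub_taylorTruncation_sq [NeZero n] (K : ℕ) (f : HardySpace n) :
    ENNReal.ofReal ‖f - taylorTruncation K f‖ ^ 2 =
      ∑' j, sphereSqNorm (homogeneousPart n (j + K) f).1 := by
  rw [HardySpace.ofReal_norm_sq, ← ENNReal.summable.sum_add_tsum_nat_add' (k := K),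
    Finset.sum_eq_zero, zero_add]
  · refine tsum_congr fun j => ?_
    rw [map_sub, Submodule.coe_sub, homogeneousPart_taylorTruncation, if_neg (by omega), sub_zero]
  · intro j hj
    rw [map_sub, Submodule.coe_sub, homogeneousPart_taylorTruncation,
      if_pos (Finset.mem_range.mp hj), sub_self, sphereSqNorm_zero]

/-- Truncation does not increase the norm and has values in a fixed finite-dimensional subspace,
where closed balls are compact. -/
theorem exists_compact_taylorTruncation_mem [NeZero n] (K : ℕ) (B : ℝ) :
    ∃ A : Set (HardySpace n), IsCompact A ∧ ∀ f, ‖f‖ ≤ B → taylorTruncation K f ∈ A := by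
  have := fun k : Fin K => finiteDimensional_homogeneousHolomorphic n k
  let V := LinearMap.range (polynomialToHardy n K)
  have : ProperSpace V := FiniteDimensional.proper ℂ V
  refine ⟨(Subtype.val : V → HardySpace n) '' closedBall 0 B,
    (isCompact_closedBall 0 B).image continuous_subtype_val, fun f hf => ?_⟩
  refine ⟨⟨taylorTruncation K f, LinearMap.mem_range_self _ _⟩, ?_, rfl⟩
  rw [mem_closedBall_zero_iff]
  exact (norm_taylorTruncation_le K f).trans hf

end Truncation

/-! ### The two implications. -/

section Main

variable {n : ℕ}

theorem totallyBounded_of_forall_taylorTruncation [NeZero n] {F : Set (HardySpace n)}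
    (hF : Bornology.IsBounded F)
    (h : ∀ ε : ℝ, 0 < ε → ∃ K, ∀ f ∈ F, ‖f - taylorTruncation K f‖ ≤ ε) : TotallyBounded F := by
  obtain ⟨B, hB⟩ := hF.exists_norm_le
  rw [Metric.totallyBounded_iff]
  intro ε hε
  obtain ⟨K, hK⟩ := h (ε / 2) (half_pos hε)
  obtain ⟨A, hA, hAmem⟩ := exists_compact_taylorTruncation_mem (n := n) K B
  obtain ⟨t, ht, htA⟩ := Metric.totallyBounded_iff.mp hA.totallyBounded (ε / 2) (half_pos hε)
  refine ⟨t, ht, fun f hf => ?_⟩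
  obtain ⟨y, hy, hfy⟩ := Set.mem_iUnion₂.mp (htA (hAmem f (hB f hf)))
  refine Set.mem_iUnion₂.mpr ⟨y, hy, ?_⟩
  have h1 := hK f hf
  rw [← dist_eq_norm] at h1
  rw [mem_ball] at hfy ⊢
  linarith [dist_triangle f (taylorTruncation K f) y]

theorem sphereSqNorm_add_le {p q : Cn n → ℂ} (hp : Continuous p) :
    sphereSqNorm (p + q) ≤ 4 * sphereSqNorm p + 4 * sphereSqNorm q := by
  have hm : Measurable fun ζ : sphere (0 : Cn n) 1 => ‖p ζ‖ₑ ^ 2 :=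
    (hp.measurable.comp measurable_subtype_coe).enorm.pow_const 2
  rw [sphereSqNorm, sphereSqNorm, sphereSqNorm, ← lintegral_const_mul' _ _ (by norm_num),
    ← lintegral_const_mul' _ _ (by norm_num), ← lintegral_add_left (hm.const_mul 4)]
  refine lintegral_mono fun ζ => ?_
  beta_reduce
  have h1 : ‖(p + q) ζ‖ₑ ≤ ‖p ζ‖ₑ + ‖q ζ‖ₑ := enorm_add_le _ _
  rcases le_total ‖p ζ‖ₑ ‖q ζ‖ₑ with h | h
  · calc ‖(p + q) ζ‖ₑ ^ 2 ≤ (‖q ζ‖ₑ + ‖q ζ‖ₑ) ^ 2 := by gcongr; exact h1.trans (by gcongr)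
      _ = 4 * ‖q ζ‖ₑ ^ 2 := by ring
      _ ≤ _ := le_add_self
  · calc ‖(p + q) ζ‖ₑ ^ 2 ≤ (‖p ζ‖ₑ + ‖p ζ‖ₑ) ^ 2 := by gcongr; exact h1.trans (by gcongr)
      _ = 4 * ‖p ζ‖ₑ ^ 2 := by ring
      _ ≤ _ := le_self_add

/-- `hardyTail` is a diagonal quadratic form, so it inherits the quasi-triangle inequality, with
constant `4`, of each spherical square norm. This moves the tail from `f` to a nearby net element.
-/
theorem hardyTail_le [NeZero n] (J : ℕ) (r : ℝ) (f g : HardySpace n) :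
    hardyTail J r (zeroExt f.toFun) ≤
      4 * hardyTail J r (zeroExt (f - g).toFun) + 4 * hardyTail J r (zeroExt g.toFun) := by
  rw [hardyTail, hardyTail, hardyTail, ← ENNReal.tsum_mul_left, ← ENNReal.tsum_mul_left,
    ← ENNReal.tsum_add]
  refine ENNReal.tsum_le_tsum fun k => ?_
  have h1 : taylorPart (k + J) (zeroExt f.toFun) = taylorPart (k + J) (zeroExt (f - g).toFun) +
      taylorPart (k + J) (zeroExt g.toFun) := by
    have h2 := congrArg Subtype.val ((homogeneousPart n (k + J)).map_add (f - g) g)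
    rw [sub_add_cancel] at h2
    exact h2
  rw [h1]
  refine (mul_le_mul_right (sphereSqNorm_add_le
    (taylorPart_mem (f - g).isHolomorphicOnBall (k + J)).1.continuous) _).trans_eq ?_
  ring

theorem tsum_sphereSqNorm_add_le [NeZero n] (K : ℕ) (f : HardySpace n) :
    ∑' k, sphereSqNorm (taylorPart (k + K) (zeroExt f.toFun)) ≤ ENNReal.ofReal ‖f‖ ^ 2 := by
  rw [HardySpace.ofReal_norm_sq]
  exact ENNReal.tsum_comp_le_tsum_of_injective (add_left_injective K)
    fun k => sphereSqNorm (homogeneousPart n k f).1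

theorem tailWeight_le (J k : ℕ) {r : ℝ} (hr : 0 < r) :
    tailWeight n J k r ≤ 2 * n * ENNReal.ofReal (1 - r) := by
  rw [tailWeight]
  gcongr
  calc _ ≤ ∫⁻ _t in Set.Ico r 1, 1 := by
        refine setLIntegral_mono' measurableSet_Ico fun t ht => ?_
        have ht0 : 0 ≤ t := hr.le.trans ht.1
        have ht1 : t ^ 2 ≤ 1 := pow_le_one₀ ht0 ht.2.le
        refine mul_le_one' ?_ ?_
        · rw [ENNReal.ofReal_le_one]; exact pow_le_one₀ ht0 ht.2.le
        · rw [ENNReal.ofReal_le_one]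
          exact pow_le_one₀ (by linarith) (by linarith [sq_nonneg t])
    _ = _ := by rw [setLIntegral_const, Real.volume_Ico, one_mul]

/-- Dominated convergence for the counting measure: for fixed `k` the multiplier vanishes with the
length of `[r,1)`, and the uniform bound `C` dominates. -/
theorem tendsto_hardyTail [NeZero n] {J : ℕ} (hJ : 1 ≤ J) (f : HardySpace n) :
    Tendsto (fun r => hardyTail J r (zeroExt f.toFun)) (𝓝[<] 1) (𝓝 0) := by
  obtain ⟨C, hC, hCle⟩ := gradientFactor_mul_tailWeight_le (n := n) hJ
  have hpos : ∀ᶠ r : ℝ in 𝓝[<] 1, 0 < r :=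
    mem_of_superset (Ioo_mem_nhdsLT (zero_lt_one (α := ℝ))) fun r hr => hr.1
  have hsum : ∑' k, sphereSqNorm (taylorPart (k + J) (zeroExt f.toFun)) ≠ ∞ :=
    ne_top_of_le_ne_top (by finiteness) (tsum_sphereSqNorm_add_le J f)
  have h := tendsto_lintegral_filter_of_dominated_convergence (μ := Measure.count (α := ℕ))
    (l := 𝓝[<] (1 : ℝ))
    (F := fun r k => (gradientFactor n k J * tailWeight n J k r) *
      sphereSqNorm (taylorPart (k + J) (zeroExt f.toFun))) (f := fun _ => 0)
    (fun k => C * sphereSqNorm (taylorPart (k + J) (zeroExt f.toFun)))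
    (Eventually.of_forall fun r => measurable_of_countable _)
    (hpos.mono fun r hr => ae_of_all _ fun k => by gcongr; exact hCle k r hr)
    (by
      rw [lintegral_count, ENNReal.tsum_mul_left]
      exact ENNReal.mul_ne_top hC hsum)
    (ae_of_all _ fun k => ?_)
  · simpa only [lintegral_count, lintegral_zero, hardyTail] using h
  · have h1 : Tendsto (fun r : ℝ => 2 * n * ENNReal.ofReal (1 - r)) (𝓝[<] 1) (𝓝 0) := by
      have h2 : Tendsto (fun r : ℝ => ENNReal.ofReal (1 - r)) (𝓝[<] 1) (𝓝 0) := by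
        have h3 : Continuous fun r : ℝ => ENNReal.ofReal (1 - r) :=
          ENNReal.continuous_ofReal.comp (by fun_prop)
        simpa using (h3.tendsto 1).mono_left (nhdsWithin_le_nhds (s := Set.Iio 1))
      simpa using ENNReal.Tendsto.const_mul h2 (Or.inr (by finiteness : (2 * n : ℝ≥0∞) ≠ ∞))
    have h2 : Tendsto (fun r => tailWeight n J k r) (𝓝[<] 1) (𝓝 0) :=
      tendsto_of_tendsto_of_tendsto_of_le_of_le' tendsto_const_nhds h1
        (Eventually.of_forall fun _ => zero_le) (hpos.mono fun r hr => tailWeight_le J k hr)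
    have h3 := ENNReal.Tendsto.const_mul h2 (Or.inr (ENNReal.natCast_ne_top (gradientFactor n k J)))
    rw [mul_zero] at h3
    have hk : sphereSqNorm (taylorPart (k + J) (zeroExt f.toFun)) ≠ ∞ :=
      ne_top_of_le_ne_top hsum (ENNReal.le_tsum k)
    simpa using ENNReal.Tendsto.mul_const h3 (Or.inr hk)

theorem hardyTail_le_norm [NeZero n] {J : ℕ} (hJ : 1 ≤ J) :
    ∃ C : ℝ≥0∞, C ≠ ∞ ∧ ∀ (f : HardySpace n) (r : ℝ), 0 < r →
      hardyTail J r (zeroExt f.toFun) ≤ C * ENNReal.ofReal ‖f‖ ^ 2 := by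
  obtain ⟨C, hC, hCle⟩ := gradientFactor_mul_tailWeight_le (n := n) hJ
  refine ⟨C, hC, fun f r hr => ?_⟩
  calc hardyTail J r (zeroExt f.toFun)
      ≤ ∑' k, C * sphereSqNorm (taylorPart (k + J) (zeroExt f.toFun)) :=
        ENNReal.tsum_le_tsum fun k => by gcongr; exact hCle k r hr
    _ ≤ _ := by
        rw [ENNReal.tsum_mul_left]
        gcongr
        exact tsum_sphereSqNorm_add_le J f

theorem tendsto_iSup_weightedTail [NeZero n] {J : ℕ} (hJ : 1 ≤ J) {F : Set (HardySpace n)}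
    (hF : TotallyBounded F) :
    Tendsto (fun r : ℝ => ⨆ f ∈ F, weightedTail J r f.toFun) (𝓝[<] 1) (𝓝 0) := by
  obtain ⟨C, hC, hCle⟩ := hardyTail_le_norm (n := n) hJ
  rw [ENNReal.tendsto_nhds_zero]
  intro ε hε
  have hε2 : 0 < ε / 2 := ENNReal.half_pos hε.ne'
  -- Within distance `δ` of a net element, the difference contributes at most `4 C δ²` to the tail,
  -- half of the allowance; the net element accounts for the other half.
  obtain ⟨δ, hδ, hδε⟩ : ∃ δ : ℝ, 0 < δ ∧ 4 * (C * ENNReal.ofReal δ ^ 2) ≤ ε / 2 := by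
    have h1 : Tendsto (fun δ : ℝ => 4 * (C * ENNReal.ofReal δ ^ 2)) (𝓝[>] 0) (𝓝 0) := by
      have h2 : Tendsto (fun δ : ℝ => ENNReal.ofReal δ ^ 2) (𝓝[>] 0) (𝓝 0) := by
        have h3 : Continuous fun δ : ℝ => ENNReal.ofReal δ ^ 2 :=
          (ENNReal.continuous_pow 2).comp ENNReal.continuous_ofReal
        simpa using (h3.tendsto 0).mono_left (nhdsWithin_le_nhds (s := Set.Ioi 0))
      have h4 := ENNReal.Tendsto.const_mul (ENNReal.Tendsto.const_mul h2 (Or.inr hC))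
        (Or.inr (by norm_num : (4 : ℝ≥0∞) ≠ ∞))
      simpa using h4
    obtain ⟨δ, h5, h6⟩ := ((h1.eventually_le_const hε2).and self_mem_nhdsWithin).exists
    exact ⟨δ, h6, h5⟩
  obtain ⟨t, ht, htF⟩ := Metric.totallyBounded_iff.mp hF δ hδ
  have hnet : ∀ᶠ r : ℝ in 𝓝[<] 1, ∀ g ∈ t, 4 * hardyTail J r (zeroExt g.toFun) ≤ ε / 2 := by
    rw [Filter.eventually_all_finite ht]
    intro g _
    have h1 := ENNReal.Tendsto.const_mul (tendsto_hardyTail hJ g)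
      (Or.inr (by norm_num : (4 : ℝ≥0∞) ≠ ∞))
    rw [mul_zero] at h1
    exact h1.eventually_le_const hε2
  filter_upwards [hnet, Ioo_mem_nhdsLT (zero_lt_one (α := ℝ))] with r hr hr01
  refine iSup₂_le fun f hf => ?_
  obtain ⟨g, hg, hfg⟩ := Set.mem_iUnion₂.mp (htF hf)
  rw [mem_ball, dist_eq_norm] at hfg
  calc weightedTail J r f.toFun ≤ hardyTail J r (zeroExt f.toFun) :=
        weightedTail_le_hardyTail J f.isHolomorphicOnBall hr01.1
    _ ≤ _ := hardyTail_le J r f g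
    _ ≤ ε / 2 + ε / 2 := by
        refine add_le_add (le_trans ?_ hδε) (hr g hg)
        gcongr
        refine (hCle (f - g) r hr01.1).trans ?_
        gcongr
    _ = ε := ENNReal.add_halves ε

theorem exists_norm_sub_taylorTruncation_le [NeZero n] {J : ℕ} (hJ : 1 ≤ J)
    {F : Set (HardySpace n)}
    (hF : Tendsto (fun r : ℝ => ⨆ f ∈ F, weightedTail J r f.toFun) (𝓝[<] 1) (𝓝 0))
    {ε : ℝ} (hε : 0 < ε) : ∃ K, ∀ f ∈ F, ‖f - taylorTruncation K f‖ ≤ ε := by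
  obtain ⟨c, hc0, hct, hc⟩ := le_gradientFactor_mul_tailWeight (n := n) hJ
  have hn0 : ((n : ℝ≥0∞)) ^ J ≠ 0 := pow_ne_zero _ (by exact_mod_cast NeZero.ne n)
  have hnt : ((n : ℝ≥0∞)) ^ J ≠ ∞ := by finiteness
  -- The threshold absorbs the loss `n^J` from passing to `hardyTail` and the lower bound `c` of the
  -- multipliers, leaving `ε²`.
  have hη : 0 < c * ENNReal.ofReal ε ^ 2 / (n : ℝ≥0∞) ^ J := by
    refine ENNReal.div_pos (mul_ne_zero hc0 (pow_ne_zero _ ?_)) hnt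
    rw [ne_eq, ENNReal.ofReal_eq_zero, not_le]
    exact hε
  obtain ⟨r, hr, hr01⟩ := ((hF.eventually_le_const hη).and
    (Ioo_mem_nhdsLT (zero_lt_one (α := ℝ)))).exists
  obtain ⟨K, hK⟩ := hc r hr01.2
  -- The multiplier of index `k` acts on degree `k + J`, so indices from `K` on control degrees from
  -- `K + J` on.
  refine ⟨K + J, fun f hf => ?_⟩
  rw [← ENNReal.ofReal_le_ofReal_iff hε.le, ← ENNReal.pow_le_pow_left_iff two_ne_zero,
    ofReal_norm_sub_taylorTruncation_sq, ← ENNReal.mul_le_mul_iff_right hc0 hct,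
    ← ENNReal.tsum_mul_left]
  calc ∑' j, c * sphereSqNorm (homogeneousPart n (j + (K + J)) f).1
      ≤ ∑' j, (gradientFactor n (j + K) J * tailWeight n J (j + K) r) *
          sphereSqNorm (taylorPart (j + K + J) (zeroExt f.toFun)) := by
        refine ENNReal.tsum_le_tsum fun j => ?_
        rw [add_assoc j K J]
        exact mul_le_mul_left (hK (j + K) (Nat.le_add_left K j)) _
    _ ≤ hardyTail J r (zeroExt f.toFun) :=
        ENNReal.tsum_comp_le_tsum_of_injective (add_left_injective K) _
    _ ≤ (n : ℝ≥0∞) ^ J * weightedTail J r f.toFun :=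
        hardyTail_le_weightedTail J f.isHolomorphicOnBall hr01.1
    _ ≤ (n : ℝ≥0∞) ^ J * (c * ENNReal.ofReal ε ^ 2 / (n : ℝ≥0∞) ^ J) := by
        gcongr
        exact (le_iSup₂ (f := fun (f : HardySpace n) (_ : f ∈ F) => weightedTail J r f.toFun)
          f hf).trans hr
    _ = c * ENNReal.ofReal ε ^ 2 := ENNReal.mul_div_cancel hn0 hnt

end Main

end

theorem mainTheorem8 (n : ℕ) [NeZero n] (J : ℕ) (hJ : 1 ≤ J)
    (F : Set (HardySpace n)) (hF : Bornology.IsBounded F) :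
    IsCompact (closure F) ↔
      Tendsto (fun r : ℝ => ⨆ f ∈ F, weightedTail J r f.toFun) (𝓝[<] 1) (𝓝 0) := by
  constructor
  · intro h
    exact tendsto_iSup_weightedTail hJ (h.totallyBounded.subset subset_closure)
  · intro h
    exact isCompact_iff_totallyBounded_isComplete.mpr ⟨(totallyBounded_of_forall_taylorTruncation hF
      fun ε hε => exists_norm_sub_taylorTruncation_le hJ h hε).closure, isClosed_closure.isComplete⟩
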